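/- Let $U_1, U_2, \dots$ be i.i.d. uniform$(0,1)$ random variables (the seeds), let $0 \le \alpha \le 1$, and let $(m_n)_{n\ge1}$ be integers with $1 \le m_n \le n$ and $m_n/n \to \alpha$. Let $\beta : (0,1)^2 \to [0,\infty)$ be a measurable symmetric function; $\beta(u,t)$ is the cost of comparing the keys with seeds $u$ and $t$. QuickVal. Put $L_0 = 0$, $R_0 = 1$ and, for $k \ge 1$, $$\tau_k = \inf\{i : L_{k-1} < U_i < R_{k-1}\},\qquad (L_k, R_k) = \begin{cases} (U_{\tau_k}, R_{k-1}) & \text{if } U_{\tau_k} < \alpha,\\ (L_{k-1}, U_{\tau_k}) & \text{if } U_{\tau_k} > \alpha\end{cases}$$ (almost surely, $\tau_k<\infty$ and $U_{\tau_k}\neq\alpha$ for all $k$), and $$I_k = \int_{L_{k-1}}^{R_{k-1}} \beta(u, U_{\tau_k})\,du, \qquad S = \sum_{k \ge 1} I_k \in [0,\infty].$$ QuickQuant$(n,\alpha)$. This is QuickSelect applied to find the key of rank $m_n$ in the file of the $n$ keys with seeds $U_1,\dots,U_n$, where each pivot is the eligible key of smallest index. Put $L_0(n) = 0$, $R_0(n)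 = 1$ and, for $k \ge 1$, $$\tau_k(n) = \inf\{i \le n : L_{k-1}(n) < U_i < R_{k-1}(n)\}, \qquad \inf \emptyset = \infty.$$ If $\tau_k(n) = \infty$, let $(L_k(n), R_k(n)) = (L_{k-1}(n), R_{k-1}(n))$. Otherwise let $r_k(n)$ be the rank of $U_{\tau_k(n)}$ among $U_1, \dots, U_n$ and let $$L_k(n) = \begin{cases} U_{\tau_k(n)} & \text{if } r_k(n) \le m_n,\\ L_{k-1}(n) & \text{if } r_k(n) > m_n,\end{cases} \qquad R_k(n) = \begin{cases} U_{\tau_k(n)} & \text{if } r_k(n) \ge m_n,\\ R_{k-1}(n) & \text{if } r_k(n) < m_n.\end{cases}$$ The total cost is $$S_n^{\mathrm Q} = \sum_{k \ge 1}\ \sum_{i:\, \tau_k(n) < i \le n} \mathbf 1\bigl(L_{k-1}(n) < U_i < R_{k-1}(n)\bigr)\, \beta(U_i, U_{\tau_k(n)}).$$ Theorem. Let $1 \le p < \infty$, and suppose that $\beta$ is $\varepsilon$-tame for some $\varepsilon$ with $0<\varepsilon < 1/p$; that is, there is a constant $c \in (0,\infty)$ with $\beta(u,t) \le c\,(t-u)^{-\varepsilon}$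 whenever $0 < u < t < 1$. Then $S < \infty$ almost surely, $S \in L^p$, $S_n^{\mathrm Q}/n \in L^p$ for every $n \ge 1$, and $$\lim_{n \to \infty} \mathbf E \left| \frac{S_n^{\mathrm Q}}{n} - S \right|^p = 0.$$ -/

import Mathlib

/-!
Seeds are indexed from `0`: for a seed sequence `u : ℕ → ℝ`, the file of `n` keys consists of the
keys with seeds `u 0, …, u (n - 1)`. Pivots are also indexed from `0`, so that pivot number `k` is
chosen inside the interval `(L_k, R_k)`, which starts from `(L_0, R_0) = (0, 1)`.
All random quantities are functions of the seed sequence.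
-/

noncomputable section

namespace QuickSelect

open scoped ENNReal

/-- A symmetric cost function: `β u t` is the cost of comparing the keys with seeds `u` and `t`.
Only the values at seeds in `(0, 1)` matter; measurability on the whole plane is no restriction,
as `β` may be extended by zero. -/
structure IsCost (β : ℝ → ℝ → ℝ) : Prop where
  measurable : Measurable (Function.uncurry β)
  nonneg : ∀ u ∈ Set.Ioo (0 : ℝ) 1, ∀ t ∈ Set.Ioo (0 : ℝ) 1, 0 ≤ β u t
  symm : ∀ u ∈ Set.Ioo (0 : ℝ) 1, ∀ t ∈ Set.Ioo (0 : ℝ) 1, β u t = β t u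

/-- `β` is tame with parameters `ε` and `c`. -/
def IsTameWith (ε c : ℝ) (β : ℝ → ℝ → ℝ) : Prop :=
  0 < ε ∧ 0 < c ∧ ∀ u t : ℝ, 0 < u → u < t → t < 1 → β u t ≤ c * (t - u) ^ (-ε)

/-- `β` is `ε`-tame. -/
def IsTame (ε : ℝ) (β : ℝ → ℝ → ℝ) : Prop :=
  ∃ c : ℝ, IsTameWith ε c β

/-! ### QuickVal: the target is the population quantile, with seed `α` -/

/-- The index of the first seed in the open interval `(I.1, I.2)`; it is `⊤` if there is none. -/
def valIndex (u : ℕ → ℝ) (I : ℝ × ℝ) : ℕ∞ :=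
  ⨅ i ∈ {i : ℕ | I.1 < u i ∧ u i < I.2}, (i : ℕ∞)

/-- The interval `(L_k, R_k)` of seeds still under consideration after `k` pivots. The ties
`u τ = α` and the case `τ = ⊤` have probability zero for uniform seeds. -/
def valBounds (α : ℝ) (u : ℕ → ℝ) : ℕ → ℝ × ℝ
  | 0 => (0, 1)
  | k + 1 =>
    let I := valBounds α u k
    let τ := valIndex u I
    if τ = ⊤ then I
    else if u τ.toNat < α then (u τ.toNat, I.2)
    else (I.1, u τ.toNat)

/-- The index `τ_k` of the pivot chosen in `(L_k, R_k)`. -/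
def valPivot (α : ℝ) (u : ℕ → ℝ) (k : ℕ) : ℕ∞ :=
  valIndex u (valBounds α u k)

/-- `I_k`, the integral of `β v (u τ_k)` over `v` in `(L_k, R_k)`, as a number in `[0, ∞]`. -/
def limitTerm (β : ℝ → ℝ → ℝ) (α : ℝ) (u : ℕ → ℝ) (k : ℕ) : ℝ≥0∞ :=
  ∫⁻ v in Set.Ioo (valBounds α u k).1 (valBounds α u k).2,
    ENNReal.ofReal (β v (u (valPivot α u k).toNat))

/-- The limit `S`, the sum of all `I_k`, as a number in `[0, ∞]`. -/
def limitS (β : ℝ → ℝ → ℝ) (α : ℝ) (u : ℕ → ℝ) : ℝ≥0∞ :=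
  ∑' k, limitTerm β α u k

/-! ### QuickQuant: the target is the key of rank `m` in the file of `n` keys -/

/-- The index of the first of the `n` seeds in the open interval `(I.1, I.2)`; it is `⊤` if there
is none. -/
def quantIndex (n : ℕ) (u : ℕ → ℝ) (I : ℝ × ℝ) : ℕ∞ :=
  ⨅ i ∈ {i : ℕ | i < n ∧ I.1 < u i ∧ u i < I.2}, (i : ℕ∞)

/-- The rank (from `1`, the smallest, to `n`) of the seed value `x` among the `n` seeds. -/
def rank (n : ℕ) (u : ℕ → ℝ) (x : ℝ) : ℕ :=
  ((Finset.range n).filter fun i : ℕ => u i ≤ x).card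

/-- The interval `(L_k(n), R_k(n))` of seeds still under consideration after `k` pivots. It becomes
empty once the key of rank `m` has been a pivot. -/
def quantBounds (n m : ℕ) (u : ℕ → ℝ) : ℕ → ℝ × ℝ
  | 0 => (0, 1)
  | k + 1 =>
    let I := quantBounds n m u k
    let τ := quantIndex n u I
    if τ = ⊤ then I
    else
      (if rank n u (u τ.toNat) ≤ m then u τ.toNat else I.1,
        if m ≤ rank n u (u τ.toNat) then u τ.toNat else I.2)

/-- The index `τ_k(n)` of the pivot chosen in `(L_k(n), R_k(n))`. -/
def quantPivot (n m : ℕ) (u : ℕ → ℝ) (k : ℕ) : ℕ∞ :=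
  quantIndex n u (quantBounds n m u k)

/-- The cost of all comparisons of the `n` keys with pivot number `k`. -/
def quantTerm (β : ℝ → ℝ → ℝ) (n m : ℕ) (u : ℕ → ℝ) (k : ℕ) : ℝ :=
  ∑ i ∈ (Finset.range n).filter fun i : ℕ =>
      quantPivot n m u k < (i : ℕ∞) ∧
        (quantBounds n m u k).1 < u i ∧ u i < (quantBounds n m u k).2,
    β (u i) (u (quantPivot n m u k).toNat)

/-- The total cost of finding the key of rank `m` in the file of `n` keys. At most `n` of the terms
are nonzero, since every pivot is removed from the keys under consideration. -/
def quantCost (β : ℝ → ℝ → ℝ) (n m : ℕ) (u : ℕ → ℝ) : ℝ :=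
  ∑' k, quantTerm β n m u k

end QuickSelect

end

/-!
The key estimate is a bound on the mean `q`-th power of the cost of a single round of QuickQuant, of
the form `C * ρ ^ k * n ^ q` with `ρ < 1`, for round `k`, all `n` and all target ranks; here `q ≥ 1`
and `ε * q < 1` (`eLpNorm_quantTerm_le`).

To prove it, a round is viewed as a map `step` on pairs of a set `A` of eligible keys and the rank,
within `A`, of the key that is sought, and the mean is taken over the seeds of `A`, independent and
uniform in an interval `(a, c)`. Given the seed `t` of the first pivot and the set `B ⊆ A` of the
keys below it, the keys of `B` are independent and uniform in `(a, t)`, the remaining ones in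
`(t, c)`, and which of the two sides survives depends only on the size of `B`. Thus the bound for
round `k + 1` follows from the bound for round `k` by an integration over `t`
(`lmarginal_roundCost_le`). In an interval of length `ℓ`, the `q`-th power of the cost of a
comparison has a mean of order `ℓ ^ (-s)`, with `s = ε * q`. By the Beta integral, if the first pivot
splits an interval of length `1` so that `i` of `n` keys survive, the surviving part has mean
`-s`-th power `growth s n / growth s i`. Hence, after division by `growth s n`, there remains a
recursion on ranks alone: the pivot has a uniform rank, and the mean of the `(q - s)`-th power of
the number of surviving keys shrinks by a constant factor
(`sum_rpow_le_shrink`).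

For a fixed round, convergence holds almost surely. The strong law of large numbers, applied for
parameters that are functions of finitely many seeds (`ae_tendsto_average`), shows that the rank of
each pivot, divided by `n`, tends to its seed. As the seed differs from `α`, QuickQuant and QuickVal
have the same interval after `k` rounds for all large `n`, and the average cost of the comparisons
with its pivot tends to the integral of the cost over that interval
(`IsTypical.tendsto_quantTerm`).

The moment bound for some `q > p` makes each round uniformly integrable in `L^p`, so that its cost
converges in `L^p`, and it dominates the series over the rounds (`tendsto_eLpNorm_series`).
-/

noncomputable section

namespace QuickSelect

open MeasureTheory ProbabilityTheory Filter Topology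
open scoped ENNReal

/-! ### Gamma quotients, Beta integrals and the rank of a random pivot -/

/-- The ratio `Γ(n + 1) / Γ(n + 1 - s)`, of order `n ^ s`. The length of the interval between two
order statistics of `n` uniform points, `j + 1` ranks apart, has mean `-s`-th power
`growth s n / growth s j`. -/
def growth (s : ℝ) (n : ℕ) : ℝ := Real.Gamma (n + 1) / Real.Gamma (n + 1 - s)

lemma growth_pos {s : ℝ} (hs : s < 1) (n : ℕ) : 0 < growth s n := by
  have hn : (0 : ℝ) ≤ n := n.cast_nonneg
  exact div_pos (Real.Gamma_pos_of_pos (by linarith)) (Real.Gamma_pos_of_pos (by linarith))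

lemma growth_succ {s : ℝ} (hs : s < 1) (n : ℕ) :
    growth s (n + 1) = growth s n * ((n + 1) / (n + 1 - s)) := by
  have hn : (0 : ℝ) ≤ n := n.cast_nonneg
  unfold growth
  push_cast
  rw [Real.Gamma_add_one (s := (n : ℝ) + 1) (by linarith),
    show (n : ℝ) + 1 + 1 - s = (n + 1 - s) + 1 by ring,
    Real.Gamma_add_one (s := (n : ℝ) + 1 - s) (by linarith)]
  have := (Real.Gamma_pos_of_pos (show 0 < (n : ℝ) + 1 - s by linarith)).ne'
  have h2 : (n : ℝ) + 1 - s ≠ 0 := by linarith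
  field_simp

lemma mul_rpow_le_growth {s : ℝ} (h0 : 0 < s) (hs : s < 1) (n : ℕ) :
    growth s 0 * ((n : ℝ) + 1) ^ s ≤ growth s n := by
  induction n with
  | zero => simp
  | succ n ih =>
    have hn : (0 : ℝ) ≤ n := n.cast_nonneg
    rw [growth_succ hs]
    have h1 : (((n : ℝ) + 1 + 1) / (n + 1)) ^ s ≤ (n + 1) / (n + 1 - s) := by
      have := _root_.rpow_one_add_le_one_add_mul_self (s := 1 / ((n : ℝ) + 1)) (p := s)
        (by have : (0 : ℝ) ≤ 1 / ((n : ℝ) + 1) := by positivity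
            linarith) h0.le hs.le
      rw [show 1 + 1 / ((n : ℝ) + 1) = (n + 1 + 1) / (n + 1) by field_simp] at this
      refine this.trans ?_
      rw [le_div_iff₀ (by linarith)]
      have h3 : (1 + s * (1 / ((n : ℝ) + 1))) * (n + 1 - s) = (n + 1) - s ^ 2 / (n + 1) := by
        field_simp
        ring
      have : 0 ≤ s ^ 2 / ((n : ℝ) + 1) := by positivity
      linarith
    calc growth s 0 * (((n + 1 : ℕ) : ℝ) + 1) ^ s
        = growth s 0 * ((n : ℝ) + 1) ^ s * (((n : ℝ) + 1 + 1) / (n + 1)) ^ s := by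
          rw [Real.div_rpow (by positivity) (by positivity)]
          have : ((n : ℝ) + 1) ^ s ≠ 0 := (by positivity : 0 < ((n : ℝ) + 1) ^ s).ne'
          push_cast
          field_simp
      _ ≤ growth s n * ((n + 1) / (n + 1 - s)) := by
          gcongr
          exact (growth_pos hs n).le

lemma growth_le_mul_rpow {s : ℝ} (h0 : 0 < s) (hs : s < 1) (n : ℕ) :
    growth s (n + 1) ≤ growth s 1 * ((n : ℝ) + 1) ^ s := by
  induction n with
  | zero => simp
  | succ n ih =>
    have hn : (0 : ℝ) ≤ n := n.cast_nonneg
    rw [growth_succ hs]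
    have h1 : (((n + 1 : ℕ) : ℝ) + 1) / ((n + 1 : ℕ) + 1 - s)
        ≤ (((n : ℝ) + 1 + 1) / (n + 1)) ^ s := by
      have hle : -1 ≤ -(1 / ((n : ℝ) + 1 + 1)) := by
        have : 1 / ((n : ℝ) + 1 + 1) ≤ 1 := by
          rw [div_le_one (by positivity)]; linarith
        linarith
      have := _root_.rpow_one_add_le_one_add_mul_self (s := -(1 / ((n : ℝ) + 1 + 1))) (p := s)
        hle h0.le hs.le
      rw [show 1 + -(1 / ((n : ℝ) + 1 + 1)) = (((n : ℝ) + 1 + 1) / (n + 1))⁻¹ by field_simp; ring,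
        Real.inv_rpow (by positivity)] at this
      have h4 : ((n : ℝ) + 1 + 1) / (n + 1 + 1 - s) = (1 + s * -(1 / ((n : ℝ) + 1 + 1)))⁻¹ := by
        rw [← inv_div]
        congr 1
        field_simp
        ring
      push_cast
      rw [h4]
      exact inv_le_of_inv_le₀ (by positivity) this
    calc growth s (n + 1) * ((((n + 1 : ℕ) : ℝ) + 1) / ((n + 1 : ℕ) + 1 - s))
        ≤ growth s 1 * ((n : ℝ) + 1) ^ s * (((n : ℝ) + 1 + 1) / (n + 1)) ^ s := by
          have := growth_pos hs 1
          refine mul_le_mul ih h1 (div_nonneg (by positivity) ?_) (by positivity)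
          push_cast
          linarith
      _ = growth s 1 * (((n + 1 : ℕ) : ℝ) + 1) ^ s := by
          rw [Real.div_rpow (by positivity) (by positivity)]
          have : ((n : ℝ) + 1) ^ s ≠ 0 := (by positivity : 0 < ((n : ℝ) + 1) ^ s).ne'
          push_cast
          field_simp

/-- The mean of `x ^ (-s)`, restricted to the event that exactly `c` of `c + d` independent uniform
points are below the independent uniform point `x`: that event has probability `1 / (c + d + 1)`. -/
lemma choose_mul_beta {s : ℝ} (hs : s < 1) (c d : ℕ) :
    ((c + d).choose c : ℝ) * beta (c + 1 - s) (d + 1) =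
      growth s (c + d + 1) / ((c + d + 1) * growth s c) := by
  have hc : (0 : ℝ) ≤ c := c.cast_nonneg
  have hd : (0 : ℝ) ≤ d := d.cast_nonneg
  rw [Nat.choose_symm_add, Nat.add_choose,
    Nat.cast_div (Nat.factorial_mul_factorial_dvd_factorial_add c d) (by positivity)]
  unfold beta growth
  push_cast
  rw [Real.Gamma_add_one (s := (c : ℝ) + d + 1) (by positivity), Real.Gamma_nat_eq_factorial c,
    Real.Gamma_nat_eq_factorial d,
    show (c : ℝ) + d + 1 = ((c + d : ℕ) : ℝ) + 1 by push_cast; ring,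
    Real.Gamma_nat_eq_factorial (c + d)]
  have h1 := (Real.Gamma_pos_of_pos (show 0 < (c : ℝ) + 1 - s by linarith)).ne'
  have h2 := (Real.Gamma_pos_of_pos (show 0 < ((c + d : ℕ) : ℝ) + 1 + 1 - s by
    push_cast; linarith)).ne'
  rw [show (c : ℝ) + 1 - s + (d + 1) = ((c + d : ℕ) : ℝ) + 1 + 1 - s by push_cast; ring]
  have h5 : ((c.factorial : ℕ) : ℝ) ≠ 0 := by positivity
  have h6 : ((d.factorial : ℕ) : ℝ) ≠ 0 := by positivity
  field_simp

lemma rpow_le_one_sub {r z : ℝ} (hr : 0 < r) (hz0 : 0 ≤ z) (hz1 : z ≤ 1) :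
    z ^ r ≤ 1 - min r 1 * (1 - z) := by
  rcases le_total r 1 with h | h
  · have := _root_.rpow_one_add_le_one_add_mul_self (s := z - 1) (p := r) (by linarith) hr.le h
    rw [min_eq_left h]
    have e : 1 + (z - 1) = z := by ring
    rw [e] at this
    linarith
  · rw [min_eq_right h]
    calc z ^ r ≤ z ^ (1 : ℝ) := Real.rpow_le_rpow_of_exponent_ge' hz0 hz1 zero_le_one h
      _ = _ := by rw [Real.rpow_one]; ring

/-- A bound, less than `1`, on the factor by which one round multiplies the mean `r`-th power of the
number of eligible keys. -/
def shrink (r : ℝ) : ℝ := 1 - min r 1 / 6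

lemma shrink_pos (r : ℝ) : 0 < shrink r := by
  unfold shrink
  have := min_le_right r 1
  linarith

lemma shrink_lt_one {r : ℝ} (hr : 0 < r) : shrink r < 1 := by
  unfold shrink
  have : 0 < min r 1 := lt_min hr one_pos
  linarith

lemma sum_succ_mul_sub (N : ℝ) (n : ℕ) :
    ∑ c ∈ Finset.range n, ((c : ℝ) + 1) * (N - c) =
      N * n * (n + 1) / 2 - (n - 1) * n * (n + 1) / 3 := by
  induction n with
  | zero => simp
  | succ n ih => rw [Finset.sum_range_succ, ih]; push_cast; ring

/-- The pivot of rank `c + 1` among `n` keys leaves `c` keys on its left and `n - 1 - c` keys on its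
right. Averaged over `c`, the `r`-th power of the size of the side that holds the key of rank `m` is
at most `shrink r * n ^ r`. -/
lemma sum_rpow_le_shrink {r : ℝ} (hr : 0 < r) (n m : ℕ) :
    ∑ c ∈ Finset.range n, (if m < c + 1 then (c : ℝ) ^ r
      else if c + 1 < m then ((n - 1 - c : ℕ) : ℝ) ^ r else 0) ≤ shrink r * n ^ r * n := by
  rcases Nat.eq_zero_or_pos n with rfl | hn
  · simp
  have hn' : (0 : ℝ) < n := by exact_mod_cast hn
  set κ := min r 1 with hκ
  have hκ0 : 0 < κ := lt_min hr one_pos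
  have key : ∀ c d : ℕ, c + d + 1 = n →
      (c : ℝ) ^ r ≤ (n : ℝ) ^ r * (1 - κ * (((c : ℝ) + 1) * (n - c)) / n ^ 2) := by
    intro c d h
    have hd : (n : ℝ) = c + d + 1 := by rw [← h]; push_cast; ring
    have hc0 : (0 : ℝ) ≤ c := c.cast_nonneg
    have hd0 : (0 : ℝ) ≤ d := d.cast_nonneg
    have h1 : ((c : ℝ) / n) ^ r ≤ 1 - κ * (1 - c / n) :=
      rpow_le_one_sub hr (by positivity) (by rw [div_le_one hn']; linarith)
    -- this lower bound is symmetric under `c ↔ n - 1 - c`, so that it serves for both sides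
    have h2 : ((c : ℝ) + 1) * (n - c) / n ^ 2 ≤ 1 - c / n := by
      rw [div_le_iff₀ (by positivity)]
      have : (1 - (c : ℝ) / n) * n ^ 2 = n * (n - c) := by field_simp
      rw [this]
      apply mul_le_mul_of_nonneg_right <;> linarith
    have h3 : (c : ℝ) ^ r = (n : ℝ) ^ r * ((c : ℝ) / n) ^ r := by
      rw [Real.div_rpow hc0 hn'.le, mul_div_cancel₀]
      positivity
    rw [h3]
    gcongr
    refine h1.trans ?_
    rw [mul_div_assoc]
    nlinarith
  calc _ ≤ ∑ c ∈ Finset.range n,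
        (n : ℝ) ^ r * (1 - κ * (((c : ℝ) + 1) * (n - c)) / n ^ 2) := by
        refine Finset.sum_le_sum fun c hc => ?_
        have hc := Finset.mem_range.mp hc
        have k1 := key c (n - 1 - c) (by omega)
        have k2 := key (n - 1 - c) c (by omega)
        have e : ((n - 1 - c : ℕ) : ℝ) = n - 1 - c := by
          rw [Nat.sub_sub, Nat.cast_sub (by omega)]; push_cast; ring
        rw [show (((n - 1 - c : ℕ) : ℝ) + 1) * (n - (n - 1 - c : ℕ)) =
          ((c : ℝ) + 1) * (n - c) by rw [e]; ring] at k2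
        split_ifs
        · exact k1
        · exact k2
        · exact le_trans (by positivity) k1
    _ = (n : ℝ) ^ r * (n - κ / n ^ 2 * ∑ c ∈ Finset.range n, ((c : ℝ) + 1) * (n - c)) := by
        rw [← Finset.mul_sum, Finset.sum_sub_distrib, Finset.mul_sum]
        simp only [Finset.sum_const, Finset.card_range, nsmul_eq_mul, mul_one]
        congr 2
        exact Finset.sum_congr rfl fun c _ => by ring
    _ ≤ shrink r * n ^ r * n := by
        rw [sum_succ_mul_sub, shrink, ← hκ]
        have : κ / (n : ℝ) ^ 2 * ((n : ℝ) * n * (n + 1) / 2 - (n - 1) * n * (n + 1) / 3)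
            = κ * (n / 6 + 1 / 2 + 1 / (3 * n)) := by field_simp; ring
        rw [this]
        have h2 : (0 : ℝ) ≤ κ * (1 / 2 + 1 / (3 * n)) := by positivity
        have h3 : (0 : ℝ) ≤ (n : ℝ) ^ r := by positivity
        nlinarith

lemma lintegral_beta_left {s a b : ℝ} (hs : s < 1) (hab : a < b) (c d : ℕ) :
    ∫⁻ x in Set.Ioo a b, ENNReal.ofReal ((x - a) ^ (c - s) * (b - x) ^ (d : ℝ)) =
      ENNReal.ofReal ((b - a) ^ ((c + d + 1 : ℝ) - s) * beta (c + 1 - s) (d + 1)) := by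
  have hc : (0 : ℝ) ≤ c := c.cast_nonneg
  have hd : (0 : ℝ) ≤ d := d.cast_nonneg
  have hba : 0 < b - a := sub_pos.mpr hab
  have hα : 0 < (c : ℝ) + 1 - s := by linarith
  have hβ : 0 < (d : ℝ) + 1 := by linarith
  have himg : (fun t => a + (b - a) * t) '' Set.Ioo 0 1 = Set.Ioo a b := by
    have := Set.image_affine_Ioo hba a (0 : ℝ) 1
    simpa [add_comm, mul_comm] using this
  rw [← himg, lintegral_image_eq_lintegral_abs_deriv_mul measurableSet_Ioo
    (f' := fun _ => b - a)]
  rotate_left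
  · intro x _
    have := ((hasDerivAt_id x).const_mul (b - a)).const_add a
    simpa using this.hasDerivWithinAt
  · intro x _ y _ h
    have : (b - a) * x = (b - a) * y := by simpa using h
    exact mul_left_cancel₀ hba.ne' this
  have hone := lintegral_betaPDF_eq_one hα hβ
  rw [lintegral_betaPDF] at hone
  have hB := beta_pos hα hβ
  calc _ = ∫⁻ x in Set.Ioo (0 : ℝ) 1,
        ENNReal.ofReal ((b - a) ^ ((c + d + 1 : ℝ) - s) * beta (c + 1 - s) (d + 1)) *
          ENNReal.ofReal (1 / beta (c + 1 - s) (d + 1) * x ^ ((c : ℝ) + 1 - s - 1) *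
            (1 - x) ^ ((d : ℝ) + 1 - 1)) := by
        refine setLIntegral_congr_fun measurableSet_Ioo fun x hx => ?_
        have hx1 : 0 < 1 - x := sub_pos.mpr hx.2
        rw [← ENNReal.ofReal_mul (abs_nonneg _), ← ENNReal.ofReal_mul (by positivity)]
        congr 1
        rw [show a + (b - a) * x - a = (b - a) * x by ring,
          show b - (a + (b - a) * x) = (b - a) * (1 - x) by ring,
          Real.mul_rpow hba.le hx.1.le, Real.mul_rpow hba.le hx1.le, abs_of_pos hba,
          show (c + d + 1 : ℝ) - s = 1 + (c - s) + d by ring, Real.rpow_add hba,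
          Real.rpow_add hba, Real.rpow_one, show (c : ℝ) + 1 - s - 1 = c - s by ring,
          show (d : ℝ) + 1 - 1 = d by ring]
        field_simp
    _ = _ := by
        rw [lintegral_const_mul _ (by fun_prop), hone, mul_one]

lemma lintegral_beta_right {s a b : ℝ} (hs : s < 1) (hab : a < b) (c d : ℕ) :
    ∫⁻ x in Set.Ioo a b, ENNReal.ofReal ((b - x) ^ (c - s) * (x - a) ^ (d : ℝ)) =
      ENNReal.ofReal ((b - a) ^ ((c + d + 1 : ℝ) - s) * beta (c + 1 - s) (d + 1)) := by
  have h := lintegral_beta_left hs (neg_lt_neg hab) c d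
  rw [show -a - -b = b - a by ring] at h
  rw [← h]
  have hpre : Neg.neg ⁻¹' Set.Ioo (-b) (-a) = Set.Ioo a b := by
    simp
  rw [← (Measure.measurePreserving_neg (volume : Measure ℝ)).setLIntegral_comp_preimage_emb
    (MeasurableEquiv.neg ℝ).measurableEmbedding _ (Set.Ioo (-b) (-a)), hpre]
  refine setLIntegral_congr_fun measurableSet_Ioo fun x _ => ?_
  rw [show -x - -b = b - x by ring, show -a - -x = x - a by ring]

/-! ### Selection as a process on sets of keys -/

/-- The pivot of a nonempty file with index set `A`: the key that comes first. -/
def firstKey (A : Finset ℕ) : ℕ := sInf (A : Set ℕ)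

lemma firstKey_mem {A : Finset ℕ} (hA : A.Nonempty) : firstKey A ∈ A := by
  have := Nat.sInf_mem (s := (A : Set ℕ)) (by exact_mod_cast hA)
  exact_mod_cast this

lemma firstKey_le {A : Finset ℕ} {i : ℕ} (hi : i ∈ A) : firstKey A ≤ i :=
  Nat.sInf_le (by exact_mod_cast hi)

/-- One round of selection. The state `(A, m)` says that the key of rank `m` among the keys with
indices in `A` is sought; when that key is the pivot, the next state is `(∅, 0)`. -/
def step (u : ℕ → ℝ) (σ : Finset ℕ × ℕ) : Finset ℕ × ℕ :=
  let r := (σ.1.filter fun i => u i ≤ u (firstKey σ.1)).card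
  if σ.2 < r then (σ.1.filter fun i => u i < u (firstKey σ.1), σ.2)
  else if r < σ.2 then (σ.1.filter fun i => u (firstKey σ.1) < u i, σ.2 - r)
  else (∅, 0)

/-- The cost of comparing all keys of the file `A` with its pivot. -/
def pivotCost (b : ℝ → ℝ → ℝ≥0∞) (u : ℕ → ℝ) (A : Finset ℕ) : ℝ≥0∞ :=
  ∑ i ∈ A.erase (firstKey A), b (u i) (u (firstKey A))

/-- The cost of round number `k`, counted from `0`, of selection started from `σ`. -/
def roundCost (b : ℝ → ℝ → ℝ≥0∞) (k : ℕ) (σ : Finset ℕ × ℕ) (u : ℕ → ℝ) : ℝ≥0∞ :=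
  pivotCost b u ((step u)^[k] σ).1

lemma roundCost_succ (b : ℝ → ℝ → ℝ≥0∞) (k : ℕ) (σ : Finset ℕ × ℕ) (u : ℕ → ℝ) :
    roundCost b (k + 1) σ u = roundCost b k (step u σ) u := rfl

lemma step_fst_subset_erase (u : ℕ → ℝ) (σ : Finset ℕ × ℕ) :
    (step u σ).1 ⊆ σ.1.erase (firstKey σ.1) := by
  intro i hi
  unfold step at hi
  simp only [] at hi
  split_ifs at hi <;> simp only [Finset.mem_filter, Finset.notMem_empty] at hi
  · exact Finset.mem_erase.mpr ⟨fun h => by simp [h] at hi, hi.1⟩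
  · exact Finset.mem_erase.mpr ⟨fun h => by simp [h] at hi, hi.1⟩

lemma step_fst_subset (u : ℕ → ℝ) (σ : Finset ℕ × ℕ) : (step u σ).1 ⊆ σ.1 :=
  (step_fst_subset_erase u σ).trans (Finset.erase_subset _ _)

lemma card_iterate_step (u : ℕ → ℝ) (k : ℕ) (σ : Finset ℕ × ℕ) :
    ((step u)^[k] σ).1.card ≤ σ.1.card - k := by
  induction k with
  | zero => simp
  | succ k ih =>
    rw [Function.iterate_succ_apply']
    set τ := (step u)^[k] σ
    rcases τ.1.eq_empty_or_nonempty with h | h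
    · have := Finset.card_le_card (step_fst_subset u τ)
      rw [h] at this
      simp at this
      simp [this]
    · have := Finset.card_le_card (step_fst_subset_erase u τ)
      rw [Finset.card_erase_of_mem (firstKey_mem h)] at this
      omega

lemma roundCost_eq_zero (b : ℝ → ℝ → ℝ≥0∞) {k : ℕ} {σ : Finset ℕ × ℕ} (h : σ.1.card ≤ k)
    (u : ℕ → ℝ) : roundCost b k σ u = 0 := by
  have := card_iterate_step u k σ
  have h0 : ((step u)^[k] σ).1 = ∅ := by
    rw [← Finset.card_eq_zero]; omega
  simp [roundCost, pivotCost, h0]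

lemma step_congr {u v : ℕ → ℝ} {σ : Finset ℕ × ℕ} (h : ∀ i ∈ σ.1, u i = v i) :
    step u σ = step v σ := by
  rcases σ.1.eq_empty_or_nonempty with h0 | h0
  · simp [step, h0]
  have hj := h _ (firstKey_mem h0)
  have h1 : (σ.1.filter fun i => u i ≤ u (firstKey σ.1)) =
      σ.1.filter fun i => v i ≤ v (firstKey σ.1) :=
    Finset.filter_congr fun i hi => by rw [h i hi, hj]
  have h2 : (σ.1.filter fun i => u i < u (firstKey σ.1)) =
      σ.1.filter fun i => v i < v (firstKey σ.1) :=
    Finset.filter_congr fun i hi => by rw [h i hi, hj]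
  have h3 : (σ.1.filter fun i => u (firstKey σ.1) < u i) =
      σ.1.filter fun i => v (firstKey σ.1) < v i :=
    Finset.filter_congr fun i hi => by rw [h i hi, hj]
  simp only [step, h1, h2, h3]

lemma pivotCost_congr (b : ℝ → ℝ → ℝ≥0∞) {u v : ℕ → ℝ} {A : Finset ℕ}
    (h : ∀ i ∈ A, u i = v i) : pivotCost b u A = pivotCost b v A := by
  rcases A.eq_empty_or_nonempty with h0 | h0
  · simp [pivotCost, h0]
  refine Finset.sum_congr rfl fun i hi => ?_
  rw [h i (Finset.mem_of_mem_erase hi), h _ (firstKey_mem h0)]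

lemma roundCost_congr (b : ℝ → ℝ → ℝ≥0∞) (k : ℕ) {u v : ℕ → ℝ} {σ : Finset ℕ × ℕ}
    (h : ∀ i ∈ σ.1, u i = v i) : roundCost b k σ u = roundCost b k σ v := by
  induction k generalizing σ with
  | zero => exact pivotCost_congr b h
  | succ k ih =>
    rw [roundCost_succ, roundCost_succ, ← step_congr h]
    exact ih fun i hi => h i (step_fst_subset u σ hi)

/-- A measurable selection from a countable family of measurable functions is measurable. -/
lemma measurable_apply_of_countable {α ι β : Type*} [MeasurableSpace α] [MeasurableSpace β]
    [Countable ι] {D : α → ι} (hD : ∀ i, MeasurableSet (D ⁻¹' {i})) {f : ι → α → β}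
    (hf : ∀ i, Measurable (f i)) : Measurable fun x => f (D x) x := by
  intro t ht
  have : (fun x => f (D x) x) ⁻¹' t = ⋃ i, D ⁻¹' {i} ∩ f i ⁻¹' t := by
    ext x; simp
  rw [this]
  exact MeasurableSet.iUnion fun i => (hD i).inter (hf i ht)

lemma measurableSet_filter_eq (A B : Finset ℕ) {p : (ℕ → ℝ) → ℕ → Prop}
    [∀ u, DecidablePred (p u)] (hp : ∀ i, MeasurableSet {u | p u i}) :
    MeasurableSet {u | A.filter (p u) = B} := by
  have : {u | A.filter (p u) = B} = ⋂ i, {u | (i ∈ A ∧ p u i) ↔ i ∈ B} := by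
    ext u
    simp [Finset.ext_iff]
  rw [this]
  refine MeasurableSet.iInter fun i => ?_
  by_cases hA : i ∈ A <;> by_cases hB : i ∈ B <;> simp only [hA, hB, true_and, false_and,
    iff_true, iff_false, Set.ofPred_true, Set.ofPred_false,
    MeasurableSet.univ, MeasurableSet.empty]
  · exact hp i
  · exact (hp i).compl

lemma measurable_roundCost {b : ℝ → ℝ → ℝ≥0∞} (hb : Measurable (Function.uncurry b)) (k : ℕ)
    (σ : Finset ℕ × ℕ) : Measurable (roundCost b k σ) := by
  induction k generalizing σ with
  | zero =>
    have : roundCost b 0 σ = fun u : ℕ → ℝ =>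
      ∑ i ∈ σ.1.erase (firstKey σ.1), b (u i) (u (firstKey σ.1)) := rfl
    rw [this]
    refine Finset.measurable_fun_sum _ fun i _ => ?_
    have h2 : Measurable fun u : ℕ → ℝ => (u i, u (firstKey σ.1)) :=
      (measurable_pi_apply i).prodMk (measurable_pi_apply _)
    exact hb.comp h2
  | succ k ih =>
    set j := firstKey σ.1 with hj
    let D : (ℕ → ℝ) → Finset ℕ × Finset ℕ × Finset ℕ := fun u =>
      (σ.1.filter fun i => u i ≤ u j, σ.1.filter fun i => u i < u j,
        σ.1.filter fun i => u j < u i)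
    let f : Finset ℕ × Finset ℕ × Finset ℕ → (ℕ → ℝ) → ℝ≥0∞ := fun d =>
      roundCost b k (if σ.2 < d.1.card then (d.2.1, σ.2)
        else if d.1.card < σ.2 then (d.2.2, σ.2 - d.1.card) else (∅, 0))
    have hD : ∀ d, MeasurableSet (D ⁻¹' {d}) := by
      rintro ⟨d1, d2, d3⟩
      have : D ⁻¹' {(d1, d2, d3)} = {u | σ.1.filter (fun i => u i ≤ u j) = d1} ∩
          ({u | σ.1.filter (fun i => u i < u j) = d2} ∩
            {u | σ.1.filter (fun i => u j < u i) = d3}) := by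
        ext u; simp [D]
      rw [this]
      refine (measurableSet_filter_eq _ _ fun i => ?_).inter
        ((measurableSet_filter_eq _ _ fun i => ?_).inter
          (measurableSet_filter_eq _ _ fun i => ?_))
      · exact measurableSet_le (measurable_pi_apply i) (measurable_pi_apply j)
      · exact measurableSet_lt (measurable_pi_apply i) (measurable_pi_apply j)
      · exact measurableSet_lt (measurable_pi_apply j) (measurable_pi_apply i)
    exact measurable_apply_of_countable hD (f := f) fun d => ih _

/-- One round of selection, where the keys of `A` other than the pivot are split into the set `B`
of the keys below the pivot and the remaining keys, above it. -/
lemma step_eq_of_split {u : ℕ → ℝ} {A B : Finset ℕ} {m : ℕ} (hA : A.Nonempty)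
    (hB : B ⊆ A.erase (firstKey A)) (hlt : ∀ i ∈ B, u i < u (firstKey A))
    (hgt : ∀ i ∈ A.erase (firstKey A) \ B, u (firstKey A) < u i) :
    step u (A, m) = if m < B.card + 1 then (B, m)
      else if B.card + 1 < m then (A.erase (firstKey A) \ B, m - (B.card + 1)) else (∅, 0) := by
  set j := firstKey A with hj
  have hjA : j ∈ A := firstKey_mem hA
  have hjB : j ∉ B := fun h => by simpa using hB h
  have h1 : A.filter (fun i => u i ≤ u j) = insert j B := by
    ext i
    simp only [Finset.mem_filter, Finset.mem_insert]
    constructor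
    · rintro ⟨hi, hle⟩
      by_contra! hcon
      have := hgt i (by simp [hi, hcon.1, hcon.2])
      linarith
    · rintro (rfl | hi)
      · exact ⟨hjA, le_rfl⟩
      · exact ⟨Finset.mem_of_mem_erase (hB hi), (hlt i hi).le⟩
  have h2 : A.filter (fun i => u i < u j) = B := by
    ext i
    simp only [Finset.mem_filter]
    constructor
    · rintro ⟨hi, hle⟩
      by_contra! hcon
      have := hgt i (by
        simp only [Finset.mem_sdiff, Finset.mem_erase]
        exact ⟨⟨fun h => by simp [h] at hle, hi⟩, hcon⟩)
      linarith
    · exact fun hi => ⟨Finset.mem_of_mem_erase (hB hi), hlt i hi⟩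
  have h3 : A.filter (fun i => u j < u i) = A.erase j \ B := by
    ext i
    simp only [Finset.mem_filter, Finset.mem_sdiff, Finset.mem_erase]
    constructor
    · rintro ⟨hi, hle⟩
      exact ⟨⟨fun h => by simp [h] at hle, hi⟩, fun h => by have := hlt i h; linarith⟩
    · intro h
      exact ⟨h.1.2, hgt i (by simp [h])⟩
  simp only [step, ← hj, h1, h2, h3, Finset.card_insert_of_notMem hjB]

/-! ### Iterated integrals over keys in an interval -/

lemma lmarginal_congr_measure {μ ν : ℕ → Measure ℝ} {A : Finset ℕ} (h : ∀ i ∈ A, μ i = ν i)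
    (f : (ℕ → ℝ) → ℝ≥0∞) : ∫⋯∫⁻_A, f ∂μ = ∫⋯∫⁻_A, f ∂ν := by
  unfold lmarginal
  rw [show (fun i : A => μ i) = fun i : A => ν i from funext fun i => h i i.2]

/-- Expansion of the product of the measures `μ + ν` over the set of coordinates that are
governed by `μ`. -/
lemma lmarginal_add_measure (μ ν : Measure ℝ) [SigmaFinite μ] [SigmaFinite ν] (A : Finset ℕ)
    {f : (ℕ → ℝ) → ℝ≥0∞} (hf : Measurable f) (x : ℕ → ℝ) :
    (∫⋯∫⁻_A, f ∂(fun _ => μ + ν)) x =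
      ∑ B ∈ A.powerset, (∫⋯∫⁻_A, f ∂(fun i => if i ∈ B then μ else ν)) x := by
  have hsf : ∀ (B : Finset ℕ) (i : ℕ), SigmaFinite (if i ∈ B then μ else ν) := fun B i => by
    split_ifs <;> infer_instance
  induction A using Finset.induction generalizing f with
  | empty => simp
  | insert j A hj ih =>
    have hm1 : Measurable fun u : ℕ → ℝ => ∫⁻ t, f (Function.update u j t) ∂μ :=
      Measurable.lintegral_prod_right (hf.comp measurable_update')
    have hm2 : Measurable fun u : ℕ → ℝ => ∫⁻ t, f (Function.update u j t) ∂ν :=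
      Measurable.lintegral_prod_right (hf.comp measurable_update')
    rw [lmarginal_insert' f hf hj, Finset.sum_powerset_insert hj]
    simp only [lintegral_add_measure]
    rw [ih (f := fun u => ∫⁻ t, f (Function.update u j t) ∂μ + ∫⁻ t, f (Function.update u j t) ∂ν)
      (hm1.add hm2), ← Finset.sum_add_distrib]
    refine Finset.sum_congr rfl fun B hB => ?_
    have hjB : j ∉ B := fun h => hj (Finset.mem_powerset.mp hB h)
    rw [lmarginal_insert' f hf hj, lmarginal_insert' f hf hj]
    simp only [hjB, if_false, Finset.mem_insert_self, if_true]
    rw [← lmarginal_congr_measure (μ := fun i => if i ∈ B then μ else ν)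
      (ν := fun i => if i ∈ insert j B then μ else ν) (A := A), add_comm]
    · simp only [lmarginal]
      rw [← lintegral_add_left]
      exact hm1.comp measurable_updateFinset
    · intro i hi
      have : i ≠ j := fun h => hj (h ▸ hi)
      simp [Finset.mem_insert, this]

lemma lmarginal_restrict_mono {I : ℕ → Set ℝ} (hI : ∀ i, MeasurableSet (I i)) {A : Finset ℕ}
    {f g : (ℕ → ℝ) → ℝ≥0∞} {x : ℕ → ℝ}
    (h : ∀ u : ℕ → ℝ, (∀ i ∈ A, u i ∈ I i) → (∀ i ∉ A, u i = x i) → f u ≤ g u) :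
    (∫⋯∫⁻_A, f ∂(fun i => volume.restrict (I i))) x ≤
      (∫⋯∫⁻_A, g ∂(fun i => volume.restrict (I i))) x := by
  unfold lmarginal
  rw [← Measure.restrict_pi_pi (fun _ : A => (volume : Measure ℝ)) (fun i : A => I i)]
  refine setLIntegral_mono' (MeasurableSet.univ_pi fun i => hI i) fun y hy => ?_
  refine h _ (fun i hi => ?_) fun i hi => ?_
  · simpa [Function.updateFinset, hi] using hy ⟨i, hi⟩ trivial
  · simp [Function.updateFinset, hi]

lemma lmarginal_of_forall_eq {μ : ℕ → Measure ℝ} [∀ i, SigmaFinite (μ i)] {A : Finset ℕ}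
    {f : (ℕ → ℝ) → ℝ≥0∞} {x : ℕ → ℝ} {c : ℝ≥0∞}
    (h : ∀ u : ℕ → ℝ, (∀ i ∉ A, u i = x i) → f u = c) :
    (∫⋯∫⁻_A, f ∂μ) x = c * ∏ i ∈ A, μ i Set.univ := by
  unfold lmarginal
  have : ∀ y : A → ℝ, f (Function.updateFinset x A y) = c := fun y =>
    h _ fun i hi => by simp [Function.updateFinset, hi]
  simp only [this, lintegral_const, Measure.pi_univ]
  rw [← Finset.prod_coe_sort A fun i => μ i Set.univ]

/-- Coordinates on which the integrand does not depend contribute their total mass. -/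
lemma lmarginal_of_subset {μ : ℕ → Measure ℝ} [∀ i, SigmaFinite (μ i)] {A B : Finset ℕ}
    (hBA : B ⊆ A) {f : (ℕ → ℝ) → ℝ≥0∞} (hf : Measurable f)
    (h : ∀ u v : ℕ → ℝ, (∀ i ∈ B, u i = v i) → f u = f v) (x : ℕ → ℝ) :
    (∫⋯∫⁻_A, f ∂μ) x = (∫⋯∫⁻_B, f ∂μ) x * ∏ i ∈ A \ B, μ i Set.univ := by
  rw [← Finset.union_sdiff_of_subset hBA, lmarginal_union μ f hf Finset.disjoint_sdiff,
    Finset.union_sdiff_of_subset hBA]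
  have : (∫⋯∫⁻_(A \ B), f ∂μ) = fun u => f u * ∏ i ∈ A \ B, μ i Set.univ := by
    funext u
    refine lmarginal_of_forall_eq fun v hv => h v u fun i hi => hv i ?_
    simp [hi]
  rw [this]
  unfold lmarginal
  rw [lintegral_mul_const]
  exact hf.comp measurable_updateFinset

lemma restrict_Ioo_split {a b x : ℝ} (hx : x ∈ Set.Ioo a b) :
    (volume.restrict (Set.Ioo a b) : Measure ℝ) =
      volume.restrict (Set.Ioo a x) + volume.restrict (Set.Ioo x b) := by
  rw [← Measure.restrict_union (by
    rw [Set.disjoint_left]; intro y h1 h2; exact absurd h1.2 (not_lt.mpr h2.1.le))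
    measurableSet_Ioo]
  refine Measure.restrict_congr_set ?_
  have h : Set.Ioo a b = (Set.Ioo a x ∪ Set.Ioo x b) ∪ {x} := by
    ext y
    simp only [Set.mem_union, Set.mem_Ioo, Set.mem_singleton_iff]
    constructor
    · intro hy
      rcases lt_trichotomy y x with h | h | h
      · exact Or.inl (Or.inl ⟨hy.1, h⟩)
      · exact Or.inr h
      · exact Or.inl (Or.inr ⟨h, hy.2⟩)
    · rintro ((h | h) | h)
      · exact ⟨h.1, h.2.trans hx.2⟩
      · exact ⟨hx.1.trans h.1, h.2⟩
      · rw [h]; exact hx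
  rw [h]
  exact union_ae_eq_left_of_ae_eq_empty (by simp)

lemma prod_restrict_Ioo {A : Finset ℕ} {I : ℕ → Set ℝ} {a c : ℝ}
    (h : ∀ i ∈ A, I i = Set.Ioo a c) :
    ∏ i ∈ A, (volume.restrict (I i) : Measure ℝ) Set.univ = ENNReal.ofReal (c - a) ^ A.card := by
  rw [Finset.prod_congr rfl fun i hi => by
    rw [h i hi, Measure.restrict_apply_univ, Real.volume_Ioo], Finset.prod_const]

/-- The bound on the mean `q`-th power of the cost of round number `k` with `n` keys whose seeds are
uniform in the unit interval. -/
def momentBound (K q s : ℝ) (k n : ℕ) : ℝ :=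
  K / growth s 0 * shrink (q - s) ^ k * growth s n * (n : ℝ) ^ (q - s)

lemma momentBound_nonneg {K q s : ℝ} (hK : 0 ≤ K) (hs : s < 1) (k n : ℕ) :
    0 ≤ momentBound K q s k n := by
  have := growth_pos hs 0
  have := growth_pos hs n
  have := shrink_pos (q - s)
  unfold momentBound
  positivity

lemma rpow_le_momentBound {K q s : ℝ} (hK : 0 ≤ K) (hq : 1 ≤ q) (hs0 : 0 < s) (hs : s < 1)
    {N n : ℕ} (hN : N ≤ n) (hn : 0 < n) :
    (N : ℝ) ^ (q - 1) * N * K ≤ momentBound K q s 0 n := by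
  have h0 := growth_pos hs 0
  have hn' : (0 : ℝ) < n := by exact_mod_cast hn
  have hNn : (N : ℝ) ≤ n := by exact_mod_cast hN
  have h1 : (N : ℝ) ^ (q - 1) * N ≤ (n : ℝ) ^ s * (n : ℝ) ^ (q - s) := by
    calc (N : ℝ) ^ (q - 1) * N ≤ (n : ℝ) ^ (q - 1) * n := by
          gcongr
      _ = (n : ℝ) ^ s * (n : ℝ) ^ (q - s) := by
          rw [← Real.rpow_add hn', ← Real.rpow_add_one hn'.ne']
          congr 1; ring
  have h2 : growth s 0 * (n : ℝ) ^ s ≤ growth s n := by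
    refine le_trans ?_ (mul_rpow_le_growth hs0 hs n)
    gcongr
    linarith
  unfold momentBound
  calc (N : ℝ) ^ (q - 1) * N * K ≤ (n : ℝ) ^ s * (n : ℝ) ^ (q - s) * K := by gcongr
    _ = K / growth s 0 * (growth s 0 * (n : ℝ) ^ s) * (n : ℝ) ^ (q - s) := by
        field_simp
    _ ≤ K / growth s 0 * growth s n * (n : ℝ) ^ (q - s) := by gcongr
    _ = _ := by ring

section Moments

variable {b : ℝ → ℝ → ℝ≥0∞} {q s K : ℝ}

/-- The mean `q`-th power of the cost of the first round. -/
lemma lmarginal_pivotCost_le (hb : Measurable (Function.uncurry b)) (hq : 1 ≤ q) (hs0 : 0 < s)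
    (hs : s < 1) (hK : 0 ≤ K) {A : Finset ℕ} (hA : A.Nonempty) {m : ℕ} {a c : ℝ} (hac : a < c)
    (hint : ∀ t, a < t → t < c →
      ∫⁻ v in Set.Ioo a c, b v t ^ q ≤ ENNReal.ofReal (K * (c - a) ^ (1 - s))) (x : ℕ → ℝ) :
    (∫⋯∫⁻_A, (fun u => roundCost b 0 (A, m) u ^ q) ∂(fun _ => volume.restrict (Set.Ioo a c))) x ≤
      ENNReal.ofReal (momentBound K q s 0 A.card * (c - a) ^ ((A.card : ℝ) - s)) := by
  have hca : 0 < c - a := sub_pos.mpr hac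
  have hm : Measurable fun u => roundCost b 0 (A, m) u ^ q :=
    (measurable_roundCost hb 0 (A, m)).pow_const q
  have hj := firstKey_mem hA
  rw [lmarginal_erase _ hm hj]
  set j := firstKey A with hjdef
  set N := (A.erase j).card with hN
  have hcard : A.card = N + 1 := by
    rw [hN, Finset.card_erase_of_mem hj]
    have := Finset.card_pos.mpr hA
    omega
  -- for a fixed pivot, each comparison has the same mean
  have hone : ∀ t ∈ Set.Ioo a c, ∀ i ∈ A.erase j,
      (∫⋯∫⁻_(A.erase j), (fun u => b (u i) (u j) ^ q)
        ∂(fun _ => volume.restrict (Set.Ioo a c))) (Function.update x j t) ≤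
        ENNReal.ofReal (K * (c - a) ^ ((N : ℝ) - s)) := by
    intro t ht i hi
    have hij : j ≠ i := fun h => by simp [← h] at hi
    have hbm : Measurable fun u : ℕ → ℝ => b (u i) (u j) ^ q := by
      have h2 : Measurable fun u : ℕ → ℝ => (u i, u j) :=
        (measurable_pi_apply i).prodMk (measurable_pi_apply _)
      exact (hb.comp h2).pow_const q
    rw [lmarginal_erase' _ hbm hi,
      lmarginal_of_forall_eq (c := ∫⁻ v in Set.Ioo a c, b v t ^ q),
      prod_restrict_Ioo (a := a) (c := c) fun _ _ => rfl]
    · rw [Finset.card_erase_of_mem hi, ← hN]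
      have hN1 : 1 ≤ N := Finset.card_pos.mpr ⟨i, hi⟩
      refine (mul_le_mul_left (hint t ht.1 ht.2) _).trans ?_
      rw [← ENNReal.ofReal_pow hca.le, ← ENNReal.ofReal_mul (by positivity),
        ← Real.rpow_natCast, mul_assoc, ← Real.rpow_add hca, Nat.cast_sub hN1]
      refine le_of_eq ?_
      congr 3
      push_cast
      ring
    · intro u hu
      have : u j = t := by
        rw [hu j (by simp)]; simp
      simp [hij, this]
  have htot : ∀ t ∈ Set.Ioo a c,
      (∫⋯∫⁻_(A.erase j), (fun u => roundCost b 0 (A, m) u ^ q)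
        ∂(fun _ => volume.restrict (Set.Ioo a c))) (Function.update x j t) ≤
        ENNReal.ofReal ((N : ℝ) ^ (q - 1) * N * K * (c - a) ^ ((N : ℝ) - s)) := by
    intro t ht
    have hbm : ∀ i, Measurable fun u : ℕ → ℝ => b (u i) (u j) ^ q := fun i => by
      have h2 : Measurable fun u : ℕ → ℝ => (u i, u j) :=
        (measurable_pi_apply i).prodMk (measurable_pi_apply _)
      exact (hb.comp h2).pow_const q
    calc _ ≤ (∫⋯∫⁻_(A.erase j),
          (fun u => (N : ℝ≥0∞) ^ (q - 1) * ∑ i ∈ A.erase j, b (u i) (u j) ^ q)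
            ∂(fun _ => volume.restrict (Set.Ioo a c))) (Function.update x j t) :=
          lmarginal_mono (fun u => ENNReal.rpow_sum_le_const_mul_sum_rpow _ _ hq) _
      _ = (N : ℝ≥0∞) ^ (q - 1) * ∑ i ∈ A.erase j, (∫⋯∫⁻_(A.erase j),
          (fun u => b (u i) (u j) ^ q)
            ∂(fun _ => volume.restrict (Set.Ioo a c))) (Function.update x j t) := by
          unfold lmarginal
          rw [lintegral_const_mul, lintegral_finsetSum]
          · exact fun i _ => (hbm i).comp measurable_updateFinset
          · exact Finset.measurable_fun_sum _ fun i _ => (hbm i).comp measurable_updateFinset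
      _ ≤ (N : ℝ≥0∞) ^ (q - 1) * ∑ i ∈ A.erase j,
            ENNReal.ofReal (K * (c - a) ^ ((N : ℝ) - s)) := by
          gcongr with i hi
          exact hone t ht i hi
      _ = _ := by
          rw [Finset.sum_const, ← hN, nsmul_eq_mul, ← ENNReal.ofReal_natCast,
            ENNReal.ofReal_rpow_of_nonneg (by positivity) (by linarith),
            ← ENNReal.ofReal_mul (by positivity), ← ENNReal.ofReal_mul (by positivity)]
          congr 1
          ring
  calc _ ≤ ∫⁻ _ in Set.Ioo a c,
        ENNReal.ofReal ((N : ℝ) ^ (q - 1) * N * K * (c - a) ^ ((N : ℝ) - s)) :=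
        setLIntegral_mono' measurableSet_Ioo htot
    _ = ENNReal.ofReal ((N : ℝ) ^ (q - 1) * N * K * (c - a) ^ ((A.card : ℝ) - s)) := by
        rw [lintegral_const, Measure.restrict_apply_univ, Real.volume_Ioo,
          ← ENNReal.ofReal_mul (by positivity), mul_assoc _ _ (c - a), hcard,
          show (((N + 1 : ℕ) : ℝ) - s) = (N - s) + 1 by push_cast; ring,
          Real.rpow_add_one hca.ne']
    _ ≤ _ := by
        refine ENNReal.ofReal_le_ofReal ?_
        gcongr
        exact rpow_le_momentBound hK hq hs0 hs (by omega) (by omega)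

/-- The bound on the mean cost of round `k + 1` in the interval `(a, c)`, restricted to the event
that the first pivot has the seed `t` and that the keys on its left form a given set of size `i`,
those on its right a set of size `d`. -/
def splitBound (K q s : ℝ) (k m i d : ℕ) (a c t : ℝ) : ℝ≥0∞ :=
  if m < i + 1 then
    ENNReal.ofReal (momentBound K q s k i * ((t - a) ^ ((i : ℝ) - s) * (c - t) ^ (d : ℝ)))
  else if i + 1 < m then
    ENNReal.ofReal (momentBound K q s k d * ((c - t) ^ ((d : ℝ) - s) * (t - a) ^ (i : ℝ)))
  else 0

lemma measurable_splitBound (K q s : ℝ) (k m i d : ℕ) (a c : ℝ) :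
    Measurable (splitBound K q s k m i d a c) := by
  unfold splitBound
  split_ifs <;> fun_prop

lemma lintegral_splitBound (hK : 0 ≤ K) (hs : s < 1) (k m i d : ℕ) {a c : ℝ} (hac : a < c) :
    ((i + d).choose i : ℝ≥0∞) * ∫⁻ t in Set.Ioo a c, splitBound K q s k m i d a c t =
      ENNReal.ofReal (K / growth s 0 * shrink (q - s) ^ k * growth s (i + d + 1) /
        (i + d + 1 : ℝ) * (c - a) ^ ((i + d + 1 : ℝ) - s) *
        (if m < i + 1 then (i : ℝ) ^ (q - s) else if i + 1 < m then (d : ℝ) ^ (q - s) else 0)) := by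
  have hca : 0 < c - a := sub_pos.mpr hac
  have hgi := growth_pos hs i
  have hgd := growth_pos hs d
  have hr := shrink_pos (q - s)
  have hg0 := growth_pos hs 0
  have hn : (0 : ℝ) < i + d + 1 := by positivity
  unfold splitBound
  split_ifs
  · simp only [ENNReal.ofReal_mul (momentBound_nonneg hK hs k i)]
    rw [lintegral_const_mul _ (by fun_prop), lintegral_beta_left hs hac,
      ← ENNReal.ofReal_mul (momentBound_nonneg hK hs k i), ← ENNReal.ofReal_natCast,
      ← ENNReal.ofReal_mul (by positivity)]
    congr 1
    have h := choose_mul_beta hs i d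
    calc _ = momentBound K q s k i * (c - a) ^ ((i + d + 1 : ℝ) - s) *
          (((i + d).choose i : ℝ) * beta (i + 1 - s) (d + 1)) := by ring
      _ = _ := by
          rw [h, momentBound]
          field_simp
  · simp only [ENNReal.ofReal_mul (momentBound_nonneg hK hs k d)]
    rw [lintegral_const_mul _ (by fun_prop), lintegral_beta_right hs hac,
      ← ENNReal.ofReal_mul (momentBound_nonneg hK hs k d), ← ENNReal.ofReal_natCast,
      ← ENNReal.ofReal_mul (by positivity)]
    congr 1
    have h := choose_mul_beta hs d i
    rw [add_comm d i, ← Nat.choose_symm_add] at h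
    calc _ = momentBound K q s k d * (c - a) ^ ((d + i + 1 : ℝ) - s) *
          (((i + d).choose i : ℝ) * beta (d + 1 - s) (i + 1)) := by ring
      _ = _ := by
          rw [h, momentBound, add_comm (d : ℝ) i]
          field_simp
  · simp

lemma sum_lintegral_splitBound_le (hK : 0 ≤ K) (hs : s < 1) (hsq : s < q) (k m N : ℕ) {a c : ℝ}
    (hac : a < c) :
    ∑ i ∈ Finset.range (N + 1),
        (N.choose i : ℝ≥0∞) * ∫⁻ t in Set.Ioo a c, splitBound K q s k m i (N - i) a c t ≤
      ENNReal.ofReal (momentBound K q s (k + 1) (N + 1) *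
        (c - a) ^ (((N + 1 : ℕ) : ℝ) - s)) := by
  have hca : 0 < c - a := sub_pos.mpr hac
  have hg := growth_pos hs (N + 1)
  have hr := shrink_pos (q - s)
  have hg0 := growth_pos hs 0
  set Q : ℝ := K / growth s 0 * shrink (q - s) ^ k * growth s (N + 1) / (N + 1 : ℝ) *
    (c - a) ^ ((N + 1 : ℝ) - s) with hQ
  have hQ0 : 0 ≤ Q := by positivity
  have hterm : ∀ i ∈ Finset.range (N + 1),
      (N.choose i : ℝ≥0∞) * ∫⁻ t in Set.Ioo a c, splitBound K q s k m i (N - i) a c t =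
        ENNReal.ofReal (Q * (if m < i + 1 then (i : ℝ) ^ (q - s)
          else if i + 1 < m then ((N + 1 - 1 - i : ℕ) : ℝ) ^ (q - s) else 0)) := by
    intro i hi
    have hi : i ≤ N := by simpa [Nat.lt_succ_iff] using hi
    have h := lintegral_splitBound (q := q) hK hs k m i (N - i) hac
    have e : (i : ℝ) + (N - i : ℕ) = N := by rw [Nat.cast_sub hi]; ring
    rw [Nat.add_sub_cancel' hi, e] at h
    rw [h, Nat.add_sub_cancel]
  rw [Finset.sum_congr rfl hterm, ← ENNReal.ofReal_sum_of_nonneg, ← Finset.mul_sum]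
  · refine ENNReal.ofReal_le_ofReal ?_
    calc _ ≤ Q * (shrink (q - s) * ((N + 1 : ℕ) : ℝ) ^ (q - s) * ((N + 1 : ℕ) : ℝ)) := by
          gcongr
          exact sum_rpow_le_shrink (sub_pos.mpr hsq) (N + 1) m
      _ = _ := by
          rw [hQ, momentBound]
          push_cast
          field_simp
          ring
  · intro i _
    refine mul_nonneg hQ0 ?_
    split_ifs <;> positivity

/-- Every round of selection shrinks the mean `q`-th power of the cost by a constant factor. The
proof conditions on the first pivot: given its seed `t` and the set of keys below it, the keys of
either side are independent and uniform in `(a, t)` and in `(t, c)`. -/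
theorem lmarginal_roundCost_le (hb : Measurable (Function.uncurry b)) (hq : 1 ≤ q) (hs0 : 0 < s)
    (hs : s < 1) (hK : 0 ≤ K)
    (hint : ∀ a t c, 0 ≤ a → a < t → t < c → c ≤ 1 →
      ∫⁻ v in Set.Ioo a c, b v t ^ q ≤ ENNReal.ofReal (K * (c - a) ^ (1 - s)))
    (k : ℕ) (A : Finset ℕ) (m : ℕ) {a c : ℝ} (ha : 0 ≤ a) (hac : a < c) (hc : c ≤ 1)
    (x : ℕ → ℝ) :
    (∫⋯∫⁻_A, (fun u => roundCost b k (A, m) u ^ q) ∂(fun _ => volume.restrict (Set.Ioo a c))) x ≤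
      ENNReal.ofReal (momentBound K q s k A.card * (c - a) ^ ((A.card : ℝ) - s)) := by
  have hq0 : 0 < q := by linarith
  rcases A.eq_empty_or_nonempty with rfl | hA
  · rw [show (fun u => roundCost b k ((∅ : Finset ℕ), m) u ^ q) = fun _ => 0 by
      funext u
      rw [roundCost_eq_zero b (by simp), ENNReal.zero_rpow_of_pos hq0]]
    simp [lmarginal]
  induction k generalizing A m a c x with
  | zero =>
    exact lmarginal_pivotCost_le hb hq hs0 hs hK hA hac
      (fun t h1 h2 => hint a t c ha h1 h2 hc) x
  | succ k ih =>
    have ih' : ∀ (A : Finset ℕ) (m : ℕ) {a c : ℝ}, 0 ≤ a → a < c → c ≤ 1 → ∀ x : ℕ → ℝ,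
        (∫⋯∫⁻_A, (fun u => roundCost b k (A, m) u ^ q)
          ∂(fun _ => volume.restrict (Set.Ioo a c))) x ≤
        ENNReal.ofReal (momentBound K q s k A.card * (c - a) ^ ((A.card : ℝ) - s)) := by
      intro A m a c ha hac hc x
      rcases A.eq_empty_or_nonempty with rfl | hA
      · rw [show (fun u => roundCost b k ((∅ : Finset ℕ), m) u ^ q) = fun _ => 0 by
          funext u
          rw [roundCost_eq_zero b (by simp), ENNReal.zero_rpow_of_pos hq0]]
        simp [lmarginal]
      · exact ih A m ha hac hc x hA
    clear ih
    have hm : ∀ k σ, Measurable fun u => roundCost b k σ u ^ q := fun k σ =>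
      (measurable_roundCost hb k σ).pow_const q
    have hj := firstKey_mem hA
    rw [lmarginal_erase _ (hm _ _) hj]
    set j := firstKey A with hjdef
    set N := (A.erase j).card with hN
    have hcard : A.card = N + 1 := by
      rw [hN, Finset.card_erase_of_mem hj]
      have := Finset.card_pos.mpr hA
      omega
    have hpt : ∀ t ∈ Set.Ioo a c,
        (∫⋯∫⁻_(A.erase j), (fun u => roundCost b (k + 1) (A, m) u ^ q)
          ∂(fun _ => volume.restrict (Set.Ioo a c))) (Function.update x j t) ≤
        ∑ i ∈ Finset.range (N + 1),
          (N.choose i : ℝ≥0∞) * splitBound K q s k m i (N - i) a c t := by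
      intro t ht
      have hca : 0 < c - t := sub_pos.mpr ht.2
      have hta : 0 < t - a := sub_pos.mpr ht.1
      -- expand over the set `B` of the keys below the pivot
      rw [restrict_Ioo_split ht, lmarginal_add_measure _ _ _ (hm _ _)]
      have hB : ∀ B ∈ (A.erase j).powerset,
          (∫⋯∫⁻_(A.erase j), (fun u => roundCost b (k + 1) (A, m) u ^ q)
            ∂(fun i => if i ∈ B then volume.restrict (Set.Ioo a t)
              else volume.restrict (Set.Ioo t c))) (Function.update x j t) ≤
          splitBound K q s k m B.card (N - B.card) a c t := by
        intro B hBm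
        have hBA := Finset.mem_powerset.mp hBm
        let I : ℕ → Set ℝ := fun i => if i ∈ B then Set.Ioo a t else Set.Ioo t c
        have hI : ∀ i, MeasurableSet (I i) := fun i => by
          simp only [I]; split_ifs <;> exact measurableSet_Ioo
        have hIB : ∀ i ∈ B, I i = Set.Ioo a t := fun i hi => by simp [I, hi]
        have hIB' : ∀ i ∈ A.erase j \ B, I i = Set.Ioo t c := fun i hi => by
          simp only [I]; rw [if_neg (Finset.mem_sdiff.mp hi).2]
        have hμ : (fun i => if i ∈ B then (volume.restrict (Set.Ioo a t) : Measure ℝ)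
            else volume.restrict (Set.Ioo t c)) = fun i => volume.restrict (I i) := by
          funext i; simp only [I]; split_ifs <;> rfl
        rw [hμ]
        refine (lmarginal_restrict_mono hI (g := fun u => roundCost b k
          (if m < B.card + 1 then (B, m) else if B.card + 1 < m then
            (A.erase j \ B, m - (B.card + 1)) else (∅, 0)) u ^ q) ?_).trans ?_
        · intro u hu hu'
          have huj : u j = t := by rw [hu' j (by simp)]; simp
          rw [roundCost_succ, step_eq_of_split hA hBA]
          · rw [← hjdef, huj]
            intro i hi
            have := hu i (hBA hi)
            rw [hIB i hi] at this
            exact this.2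
          · rw [← hjdef, huj]
            intro i hi
            have := hu i (Finset.mem_sdiff.mp hi).1
            rw [hIB' i hi] at this
            exact this.1
        · have hcs : (A.erase j \ B).card = N - B.card := Finset.card_sdiff_of_subset hBA
          unfold splitBound
          split_ifs
          · rw [lmarginal_of_subset hBA (hm _ _) (fun u v h => by rw [roundCost_congr b k h]),
              prod_restrict_Ioo hIB', hcs, lmarginal_congr_measure
                (ν := fun _ => volume.restrict (Set.Ioo a t)) fun i hi => by rw [hIB i hi]]
            refine (mul_le_mul_left (ih' B m ha ht.1 (ht.2.le.trans hc) _) _).trans ?_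
            rw [← ENNReal.ofReal_pow hca.le, ← ENNReal.ofReal_mul, ← Real.rpow_natCast, mul_assoc]
            have := momentBound_nonneg (q := q) hK hs k B.card
            positivity
          · rw [lmarginal_of_subset Finset.sdiff_subset (hm _ _)
                (fun u v h => by rw [roundCost_congr b k h]),
              Finset.sdiff_sdiff_eq_self hBA, prod_restrict_Ioo hIB, lmarginal_congr_measure
                (ν := fun _ => volume.restrict (Set.Ioo t c)) fun i hi => by rw [hIB' i hi]]
            refine (mul_le_mul_left
              (ih' _ (m - (B.card + 1)) (ha.trans ht.1.le) ht.2 hc _) _).trans ?_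
            rw [← ENNReal.ofReal_pow hta.le, ← ENNReal.ofReal_mul, ← Real.rpow_natCast, mul_assoc,
              hcs]
            have := momentBound_nonneg (q := q) hK hs k (A.erase j \ B).card
            positivity
          · rw [show (fun u => roundCost b k ((∅ : Finset ℕ), 0) u ^ q) = fun _ => 0 by
              funext u
              rw [roundCost_eq_zero b (by simp), ENNReal.zero_rpow_of_pos hq0]]
            simp [lmarginal]
      refine (Finset.sum_le_sum hB).trans (le_of_eq ?_)
      rw [Finset.sum_powerset_apply_card (fun i => splitBound K q s k m i (N - i) a c t)]
      simp [hN]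
    calc _ ≤ ∫⁻ t in Set.Ioo a c, ∑ i ∈ Finset.range (N + 1),
          (N.choose i : ℝ≥0∞) * splitBound K q s k m i (N - i) a c t :=
          setLIntegral_mono' measurableSet_Ioo hpt
      _ = ∑ i ∈ Finset.range (N + 1),
          (N.choose i : ℝ≥0∞) * ∫⁻ t in Set.Ioo a c, splitBound K q s k m i (N - i) a c t := by
          rw [lintegral_finsetSum _ fun i _ =>
            (measurable_splitBound K q s k m i (N - i) a c).const_mul _]
          refine Finset.sum_congr rfl fun i _ => ?_
          rw [lintegral_const_mul _ (measurable_splitBound K q s k m i (N - i) a c)]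
      _ ≤ _ := by
          rw [hcard]
          exact sum_lintegral_splitBound_le hK hs (by linarith) k m N hac

end Moments

/-! ### The intervals of QuickQuant as sets of keys -/

section

lemma iInf_mem_eq_top_iff {S : Set ℕ} : ⨅ i ∈ S, (i : ℕ∞) = ⊤ ↔ S = ∅ := by
  simp [iInf_eq_top, Set.eq_empty_iff_forall_notMem]

lemma iInf_mem_eq_of_isLeast {S : Set ℕ} {j : ℕ} (hj : IsLeast S j) :
    ⨅ i ∈ S, (i : ℕ∞) = j := by
  refine le_antisymm (iInf₂_le j hj.1) (le_iInf₂ fun i hi => ?_)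
  exact_mod_cast hj.2 hi

/-- The indices of the keys with seeds in the open interval `I`. -/
def eligible (n : ℕ) (u : ℕ → ℝ) (I : ℝ × ℝ) : Finset ℕ :=
  (Finset.range n).filter fun i => I.1 < u i ∧ u i < I.2

lemma mem_eligible {n : ℕ} {u : ℕ → ℝ} {I : ℝ × ℝ} {i : ℕ} :
    i ∈ eligible n u I ↔ i < n ∧ I.1 < u i ∧ u i < I.2 := by
  simp [eligible]

lemma quantIndex_of_empty {n : ℕ} {u : ℕ → ℝ} {I : ℝ × ℝ} (h : eligible n u I = ∅) :
    quantIndex n u I = ⊤ := by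
  unfold quantIndex
  rw [iInf_mem_eq_top_iff, Set.eq_empty_iff_forall_notMem]
  intro i hi
  have : i ∈ eligible n u I := mem_eligible.mpr hi
  simp [h] at this

lemma quantIndex_of_nonempty {n : ℕ} {u : ℕ → ℝ} {I : ℝ × ℝ} (h : (eligible n u I).Nonempty) :
    quantIndex n u I = firstKey (eligible n u I) :=
  iInf_mem_eq_of_isLeast ⟨mem_eligible.mp (firstKey_mem h),
    fun _ hi => firstKey_le (mem_eligible.mpr hi)⟩

/-- The rounds of QuickQuant are the iterates of `step`: the state consists of the eligible keys and
of the rank, among them, of the key that is sought. -/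
lemma iterate_step_eq_eligible {n m : ℕ} {u : ℕ → ℝ} (hu : ∀ i, u i ∈ Set.Ioo (0 : ℝ) 1) (k : ℕ) :
    ((step u)^[k] (Finset.range n, m)).1 = eligible n u (quantBounds n m u k) ∧
      ∀ i ∈ ((step u)^[k] (Finset.range n, m)).1,
        rank n u (u i) + ((step u)^[k] (Finset.range n, m)).2 =
          (((step u)^[k] (Finset.range n, m)).1.filter fun l => u l ≤ u i).card + m := by
  induction k with
  | zero =>
    refine ⟨?_, fun i _ => rfl⟩
    ext i
    simp [mem_eligible, quantBounds, (hu i).1, (hu i).2]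
  | succ k ih =>
    rw [Function.iterate_succ_apply']
    set σ := (step u)^[k] (Finset.range n, m) with hσ
    obtain ⟨ih1, ih2⟩ := ih
    set I := quantBounds n m u k with hI
    rcases σ.1.eq_empty_or_nonempty with h0 | h0
    · have h1 : (step u σ).1 = ∅ := by
        have := step_fst_subset u σ
        rw [h0] at this
        exact Finset.subset_empty.mp this
      refine ⟨?_, by simp [h1]⟩
      have h2 : quantIndex n u I = ⊤ := quantIndex_of_empty (by rw [← ih1, h0])
      rw [h1]
      simp only [quantBounds, ← hI, h2, if_true]
      rw [← ih1, h0]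
    · have hτ : quantIndex n u I = (firstKey σ.1 : ℕ∞) := by
        rw [ih1] at h0 ⊢
        exact quantIndex_of_nonempty h0
      set j := firstKey σ.1 with hj
      have hjA : j ∈ σ.1 := firstKey_mem h0
      have hrank := ih2 j hjA
      set r := (σ.1.filter fun l => u l ≤ u j).card with hr
      have hjI := hjA
      rw [ih1, mem_eligible] at hjI
      have hb : quantBounds n m u (k + 1) = (if rank n u (u j) ≤ m then u j else I.1,
          if m ≤ rank n u (u j) then u j else I.2) := by
        simp only [quantBounds, ← hI, hτ, ENat.natCast_ne_top, if_false, ENat.toNat_natCast]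
      rcases lt_trichotomy σ.2 r with h | h | h
      · have hs : step u σ = (σ.1.filter fun i => u i < u j, σ.2) := by
          simp only [step, ← hj, ← hr, if_pos h]
        rw [hb, if_neg (by omega), if_pos (by omega), hs]
        refine ⟨?_, fun i hi => ?_⟩
        · ext i
          simp only [ih1, Finset.mem_filter, mem_eligible]
          constructor
          · rintro ⟨h1, h2⟩
            exact ⟨h1.1, h1.2.1, h2⟩
          · rintro ⟨h1, h2, h3⟩
            exact ⟨⟨h1, h2, h3.trans hjI.2.2⟩, h3⟩
        · simp only [Finset.mem_filter] at hi
          rw [ih2 i hi.1, Finset.filter_filter]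
          congr 2
          refine Finset.filter_congr fun l _ => ?_
          constructor
          · exact fun h' => ⟨h'.trans_lt hi.2, h'⟩
          · exact fun h' => h'.2
      · have hs : step u σ = (∅, 0) := by
          simp only [step, ← hj, ← hr, if_neg h.not_lt, if_neg h.symm.not_lt]
        rw [hb, if_pos (by omega), if_pos (by omega), hs]
        refine ⟨?_, by simp⟩
        symm
        rw [Finset.eq_empty_iff_forall_notMem]
        intro i hi
        have := mem_eligible.mp hi
        exact absurd (this.2.1.trans this.2.2) (lt_irrefl _)
      · have hs : step u σ = (σ.1.filter fun i => u j < u i, σ.2 - r) := by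
          simp only [step, ← hj, ← hr, if_pos h, if_neg h.le.not_gt]
        rw [hb, if_pos (by omega), if_neg (by omega), hs]
        refine ⟨?_, fun i hi => ?_⟩
        · ext i
          simp only [ih1, Finset.mem_filter, mem_eligible]
          constructor
          · rintro ⟨h1, h2⟩
            exact ⟨h1.1, h2, h1.2.2⟩
          · rintro ⟨h1, h2, h3⟩
            exact ⟨⟨h1, hjI.2.1.trans h2, h3⟩, h2⟩
        · simp only [Finset.mem_filter] at hi
          have h1 := ih2 i hi.1
          have h2 : (σ.1.filter fun l => u l ≤ u i).card =
              r + ((σ.1.filter fun l => u j < u l).filter fun l => u l ≤ u i).card := by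
            rw [hr, ← Finset.card_union_of_disjoint]
            · congr 1
              ext l
              simp only [Finset.mem_filter, Finset.mem_union]
              constructor
              · rintro ⟨h3, h4⟩
                rcases le_or_gt (u l) (u j) with h5 | h5
                · exact Or.inl ⟨h3, h5⟩
                · exact Or.inr ⟨⟨h3, h5⟩, h4⟩
              · rintro (⟨h3, h4⟩ | ⟨⟨h3, _⟩, h4⟩)
                · exact ⟨h3, h4.trans hi.2.le⟩
                · exact ⟨h3, h4⟩
            · rw [Finset.disjoint_left]
              intro l h3 h4
              simp only [Finset.mem_filter] at h3 h4
              linarith [h3.2, h4.1.2]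
          simp only
          omega

lemma quantTerm_eq_sum {β : ℝ → ℝ → ℝ} {n m : ℕ} {u : ℕ → ℝ} (k : ℕ) :
    quantTerm β n m u k =
      ∑ i ∈ (eligible n u (quantBounds n m u k)).erase
          (firstKey (eligible n u (quantBounds n m u k))),
        β (u i) (u (firstKey (eligible n u (quantBounds n m u k)))) := by
  set A := eligible n u (quantBounds n m u k) with hA
  unfold quantTerm quantPivot
  rcases A.eq_empty_or_nonempty with h0 | h0
  · rw [quantIndex_of_empty h0, h0]
    simp
  · rw [quantIndex_of_nonempty h0, ← hA]
    simp only [ENat.toNat_natCast]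
    refine Finset.sum_congr ?_ fun _ _ => rfl
    ext i
    simp only [Finset.mem_filter, Finset.mem_range, Finset.mem_erase, Nat.cast_lt]
    constructor
    · rintro ⟨h1, h2, h3⟩
      exact ⟨h2.ne', mem_eligible.mpr ⟨h1, h3⟩⟩
    · rintro ⟨h1, h2⟩
      exact ⟨(mem_eligible.mp h2).1, lt_of_le_of_ne (firstKey_le h2) (Ne.symm h1),
        (mem_eligible.mp h2).2⟩

variable {β : ℝ → ℝ → ℝ} {n m : ℕ} {u : ℕ → ℝ}

lemma quantTerm_nonneg (hβ : IsCost β) (hu : ∀ i, u i ∈ Set.Ioo (0 : ℝ) 1) (k : ℕ) :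
    0 ≤ quantTerm β n m u k := by
  rw [quantTerm_eq_sum]
  exact Finset.sum_nonneg fun i _ => hβ.nonneg _ (hu _) _ (hu _)

lemma ofReal_quantTerm (hβ : IsCost β) (hu : ∀ i, u i ∈ Set.Ioo (0 : ℝ) 1) (k : ℕ) :
    ENNReal.ofReal (quantTerm β n m u k) =
      roundCost (fun v t => ENNReal.ofReal (β v t)) k (Finset.range n, m) u := by
  rw [quantTerm_eq_sum, ENNReal.ofReal_sum_of_nonneg
    fun i _ => hβ.nonneg _ (hu _) _ (hu _), roundCost, pivotCost, (iterate_step_eq_eligible hu k).1]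

lemma quantTerm_eq_toReal (hβ : IsCost β) (hu : ∀ i, u i ∈ Set.Ioo (0 : ℝ) 1) (k : ℕ) :
    quantTerm β n m u k =
      (roundCost (fun v t => ENNReal.ofReal (β v t)) k (Finset.range n, m) u).toReal := by
  rw [← ofReal_quantTerm hβ hu, ENNReal.toReal_ofReal (quantTerm_nonneg hβ hu k)]

lemma quantTerm_eq_zero (hβ : IsCost β) (hu : ∀ i, u i ∈ Set.Ioo (0 : ℝ) 1) {k : ℕ} (hk : n ≤ k) :
    quantTerm β n m u k = 0 := by
  rw [quantTerm_eq_toReal hβ hu, roundCost_eq_zero _ (by simpa using hk), ENNReal.toReal_zero]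

lemma quantCost_eq_sum (hβ : IsCost β) (hu : ∀ i, u i ∈ Set.Ioo (0 : ℝ) 1) :
    quantCost β n m u = ∑ k ∈ Finset.range n, quantTerm β n m u k :=
  tsum_eq_sum fun _ hk => quantTerm_eq_zero hβ hu (by simpa using hk)

end

/-! ### Convergence along a typical sequence of seeds -/

section

/-- The points `0`, `1`, `u 0`, `u 1`, …, which are the possible ends of the intervals. -/
def endpoint (u : ℕ → ℝ) : ℕ → ℝ
  | 0 => 0
  | 1 => 1
  | i + 2 => u i

/-- The almost sure properties of the seeds that make the cost of each round converge. -/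
structure IsTypical (β : ℝ → ℝ → ℝ) (α : ℝ) (u : ℕ → ℝ) : Prop where
  mem_Ioo : ∀ i, u i ∈ Set.Ioo (0 : ℝ) 1
  ne_target : ∀ i, u i ≠ α
  tendsto_rank : ∀ i, Tendsto (fun n : ℕ => (rank n u (u i) : ℝ) / n) atTop (𝓝 (u i))
  exists_mem : ∀ a b, endpoint u a < endpoint u b → ∃ i, endpoint u a < u i ∧ u i < endpoint u b
  tendsto_average : ∀ j a b, Tendsto (fun n : ℕ => (∑ i ∈ Finset.range n,
    (Set.Ioo (endpoint u a) (endpoint u b)).indicator (fun v => β v (u j)) (u i)) / (n : ℝ)) atTop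
      (𝓝 (∫ v in Set.Ioo (0 : ℝ) 1,
        (Set.Ioo (endpoint u a) (endpoint u b)).indicator (fun v => β v (u j)) v))

variable {β : ℝ → ℝ → ℝ} {α : ℝ} {u : ℕ → ℝ} {m : ℕ → ℕ}

lemma IsTypical.endpoint_mem (hu : IsTypical β α u) (a : ℕ) :
    0 ≤ endpoint u a ∧ endpoint u a ≤ 1 := by
  match a with
  | 0 => simp [endpoint]
  | 1 => simp [endpoint]
  | i + 2 => exact ⟨(hu.mem_Ioo i).1.le, (hu.mem_Ioo i).2.le⟩

/-- In an interval of positive length there is a first seed, and it is the pivot of QuickVal and,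
for all large `n`, of QuickQuant. -/
lemma IsTypical.exists_pivot (hu : IsTypical β α u) {a b : ℕ}
    (hab : endpoint u a < endpoint u b) :
    ∃ j, IsLeast {i : ℕ | endpoint u a < u i ∧ u i < endpoint u b} j ∧
      valIndex u (endpoint u a, endpoint u b) = j ∧
      ∀ n, j < n → quantIndex n u (endpoint u a, endpoint u b) = j := by
  obtain ⟨i, hi⟩ := hu.exists_mem a b hab
  have hne : {i : ℕ | endpoint u a < u i ∧ u i < endpoint u b}.Nonempty := ⟨i, hi⟩
  have hj := (⟨Nat.sInf_mem hne, fun _ h => Nat.sInf_le h⟩ :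
    IsLeast {i : ℕ | endpoint u a < u i ∧ u i < endpoint u b} _)
  refine ⟨_, hj, iInf_mem_eq_of_isLeast hj, fun n hn => iInf_mem_eq_of_isLeast ?_⟩
  exact ⟨⟨hn, hj.1⟩, fun l hl => hj.2 hl.2⟩

/-- After `k` rounds QuickQuant and QuickVal consider the same interval, for all large `n`. -/
lemma IsTypical.eventually_quantBounds_eq (hu : IsTypical β α u)
    (hm : Tendsto (fun n : ℕ => (m n : ℝ) / n) atTop (𝓝 α)) (k : ℕ) :
    ∃ a b, valBounds α u k = (endpoint u a, endpoint u b) ∧ endpoint u a < endpoint u b ∧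
      ∀ᶠ n in atTop, quantBounds n (m n) u k = (endpoint u a, endpoint u b) := by
  induction k with
  | zero => exact ⟨0, 1, rfl, by simp [endpoint], Eventually.of_forall fun _ => rfl⟩
  | succ k ih =>
    obtain ⟨a, b, hv, hab, hq⟩ := ih
    obtain ⟨j, hj, hvj, hqj⟩ := hu.exists_pivot hab
    have hrank := hu.tendsto_rank j
    have hval : valBounds α u (k + 1) = if u j < α then (u j, endpoint u b)
        else (endpoint u a, u j) := by
      simp only [valBounds, hv, hvj, ENat.natCast_ne_top, if_false, ENat.toNat_natCast]
    have hquant : ∀ᶠ n in atTop, quantBounds n (m n) u (k + 1) =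
        (if rank n u (u j) ≤ m n then u j else endpoint u a,
          if m n ≤ rank n u (u j) then u j else endpoint u b) := by
      filter_upwards [hq, eventually_gt_atTop j] with n hn hjn
      simp only [quantBounds, hn, hqj n hjn, ENat.natCast_ne_top, if_false, ENat.toNat_natCast]
    rcases lt_or_gt_of_ne (hu.ne_target j) with h | h
    · refine ⟨j + 2, b, by rw [hval, if_pos h]; rfl, hj.1.2, ?_⟩
      filter_upwards [hquant, hrank.eventually_lt hm h, eventually_gt_atTop 0] with n h1 h2 h3
      have h4 : rank n u (u j) < m n := by
        rw [div_lt_div_iff_of_pos_right (by exact_mod_cast h3)] at h2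
        exact_mod_cast h2
      rw [h1, if_pos h4.le, if_neg h4.not_ge]
      rfl
    · refine ⟨a, j + 2, by rw [hval, if_neg h.not_gt]; rfl, hj.1.1, ?_⟩
      filter_upwards [hquant, hm.eventually_lt hrank h, eventually_gt_atTop 0] with n h1 h2 h3
      have h4 : m n < rank n u (u j) := by
        rw [div_lt_div_iff_of_pos_right (by exact_mod_cast h3)] at h2
        exact_mod_cast h2
      rw [h1, if_neg h4.not_ge, if_pos h4.le]
      rfl

lemma measurable_cost_left (hβ : IsCost β) (t : ℝ) : Measurable fun v => β v t :=
  hβ.measurable.comp (measurable_id.prodMk measurable_const)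

/-- Along a typical sequence of seeds, the cost of each round, divided by `n`, converges. -/
lemma IsTypical.tendsto_quantTerm (hβ : IsCost β) (hu : IsTypical β α u)
    (hm : Tendsto (fun n : ℕ => (m n : ℝ) / n) atTop (𝓝 α)) (k : ℕ) :
    Tendsto (fun n : ℕ => quantTerm β n (m n) u k / n) atTop (𝓝 (limitTerm β α u k).toReal) := by
  obtain ⟨a, b, hv, hab, hq⟩ := hu.eventually_quantBounds_eq hm k
  obtain ⟨j, hj, hvj, hqj⟩ := hu.exists_pivot hab
  set I := Set.Ioo (endpoint u a) (endpoint u b) with hI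
  have hsub : I ⊆ Set.Ioo 0 1 :=
    Set.Ioo_subset_Ioo (hu.endpoint_mem a).1 (hu.endpoint_mem b).2
  have hlim : (limitTerm β α u k).toReal =
      ∫ v in Set.Ioo (0 : ℝ) 1, I.indicator (fun v => β v (u j)) v := by
    rw [limitTerm, valPivot, hv, hvj, ENat.toNat_natCast, integral_indicator measurableSet_Ioo,
      Measure.restrict_restrict measurableSet_Ioo, Set.inter_eq_left.mpr hsub,
      integral_eq_lintegral_of_nonneg_ae]
    · exact (ae_restrict_iff' measurableSet_Ioo).mpr (Eventually.of_forall fun v hv =>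
        hβ.nonneg v (hsub hv) _ (hu.mem_Ioo j))
    · exact (measurable_cost_left hβ (u j)).aestronglyMeasurable
  rw [hlim]
  have hconst : Tendsto (fun n : ℕ => β (u j) (u j) / (n : ℝ)) atTop (𝓝 0) :=
    tendsto_const_div_atTop_nhds_zero_nat _
  have h := (hu.tendsto_average j a b).sub hconst
  rw [sub_zero] at h
  refine h.congr' ?_
  filter_upwards [hq, eventually_gt_atTop j] with n hn hjn
  rw [← sub_div]
  congr 1
  have hjI : u j ∈ I := hj.1
  have hmem : j ∈ eligible n u (endpoint u a, endpoint u b) := mem_eligible.mpr ⟨hjn, hj.1⟩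
  have hkey : firstKey (eligible n u (endpoint u a, endpoint u b)) = j :=
    le_antisymm (firstKey_le hmem)
      (hj.2 (mem_eligible.mp (firstKey_mem ⟨j, hmem⟩)).2)
  -- no earlier key lies in the interval, so only the pivot itself is not compared with the pivot
  rw [quantTerm_eq_sum, hn, hkey, ← Finset.sum_erase_add _ _ (Finset.mem_range.mpr hjn),
    Set.indicator_of_mem hjI, add_sub_cancel_right, eligible, ← Finset.filter_erase,
    Finset.sum_filter]
  refine Finset.sum_congr rfl fun i _ => ?_
  simp [Set.indicator_apply, Set.mem_Ioo]

/-! ### Integrals of a tame cost -/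

/-- The constant in the bound `lintegral_rpow_cost_le`. -/
def tameConst (c q s : ℝ) : ℝ := 2 * c ^ q * beta (1 - s) 1

lemma tameConst_nonneg {c q s : ℝ} (hc : 0 < c) (hs : s < 1) : 0 ≤ tameConst c q s := by
  have := beta_pos (sub_pos.mpr hs) one_pos
  unfold tameConst
  positivity

lemma lintegral_rpow_cost_le {ε c q : ℝ} (hβ : IsCost β) (ht : IsTameWith ε c β) (hq : 0 < q)
    (hs : ε * q < 1) (a t d : ℝ) (ha : 0 ≤ a) (hat : a < t) (htd : t < d) (hd : d ≤ 1) :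
    ∫⁻ v in Set.Ioo a d, ENNReal.ofReal (β v t) ^ q ≤
      ENNReal.ofReal (tameConst c q (ε * q) * (d - a) ^ (1 - ε * q)) := by
  obtain ⟨hε, hc, hle⟩ := ht
  set s := ε * q with hsdef
  have ht01 : t ∈ Set.Ioo (0 : ℝ) 1 := ⟨by linarith, by linarith⟩
  have hB := beta_pos (sub_pos.mpr hs) one_pos
  have key : ∀ v x : ℝ, 0 < x → β v t ≤ c * x ^ (-ε) →
      ENNReal.ofReal (β v t) ^ q ≤ ENNReal.ofReal (c ^ q) * ENNReal.ofReal (x ^ (-s)) := by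
    intro v x hx h
    calc ENNReal.ofReal (β v t) ^ q ≤ ENNReal.ofReal (c * x ^ (-ε)) ^ q := by gcongr
      _ = _ := by
        rw [ENNReal.ofReal_rpow_of_nonneg (by positivity) hq.le,
          Real.mul_rpow hc.le (by positivity), ← Real.rpow_mul hx.le,
          ENNReal.ofReal_mul (by positivity), hsdef, neg_mul]
  have h1 : ∫⁻ v in Set.Ioo a t, ENNReal.ofReal (β v t) ^ q ≤
      ENNReal.ofReal (c ^ q) * ENNReal.ofReal ((d - a) ^ (1 - s) * beta (1 - s) 1) := by
    have hb := lintegral_beta_right (s := s) hs hat 0 0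
    simp only [Nat.cast_zero, zero_sub, Real.rpow_zero, mul_one, zero_add] at hb
    calc _ ≤ ∫⁻ v in Set.Ioo a t, ENNReal.ofReal (c ^ q) * ENNReal.ofReal ((t - v) ^ (-s)) :=
          setLIntegral_mono' measurableSet_Ioo fun v hv => key v (t - v) (sub_pos.mpr hv.2)
            (hle v t (by linarith [hv.1]) hv.2 ht01.2)
      _ ≤ _ := by
          rw [lintegral_const_mul _ (by fun_prop), hb]
          have := sub_pos.mpr hat
          have : 0 ≤ 1 - s := by linarith
          gcongr
  have h2 : ∫⁻ v in Set.Ioo t d, ENNReal.ofReal (β v t) ^ q ≤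
      ENNReal.ofReal (c ^ q) * ENNReal.ofReal ((d - a) ^ (1 - s) * beta (1 - s) 1) := by
    have hb := lintegral_beta_left (s := s) hs htd 0 0
    simp only [Nat.cast_zero, zero_sub, Real.rpow_zero, mul_one, zero_add] at hb
    calc _ ≤ ∫⁻ v in Set.Ioo t d, ENNReal.ofReal (c ^ q) * ENNReal.ofReal ((v - t) ^ (-s)) :=
          setLIntegral_mono' measurableSet_Ioo fun v hv => key v (v - t) (sub_pos.mpr hv.1) (by
            rw [hβ.symm v ⟨by linarith [hv.1], by linarith [hv.2]⟩ t ht01]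
            exact hle t v ht01.1 hv.1 (by linarith [hv.2]))
      _ ≤ _ := by
          rw [lintegral_const_mul _ (by fun_prop), hb]
          have := sub_pos.mpr htd
          have : 0 ≤ 1 - s := by linarith
          gcongr
  rw [restrict_Ioo_split ⟨hat, htd⟩, lintegral_add_measure]
  refine (add_le_add h1 h2).trans (le_of_eq ?_)
  have hda : 0 < d - a := by linarith
  rw [← ENNReal.ofReal_mul (by positivity), ← ENNReal.ofReal_add (by positivity) (by positivity),
    tameConst]
  congr 1
  ring

lemma integrableOn_cost {ε c : ℝ} (hβ : IsCost β) (ht : IsTameWith ε c β) (hε : ε < 1)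
    {t : ℝ} (h : t ∈ Set.Ioo (0 : ℝ) 1) : IntegrableOn (fun v => β v t) (Set.Ioo 0 1) := by
  refine ⟨(measurable_cost_left hβ t).aestronglyMeasurable, ?_⟩
  rw [hasFiniteIntegral_iff_ofReal]
  · have := lintegral_rpow_cost_le hβ ht one_pos (by linarith) 0 t 1 le_rfl h.1 h.2 le_rfl
    simp only [ENNReal.rpow_one] at this
    exact this.trans_lt ENNReal.ofReal_lt_top
  · exact (ae_restrict_iff' measurableSet_Ioo).mpr (Eventually.of_forall fun v hv =>
      hβ.nonneg v hv _ h)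

lemma IsTypical.limitTerm_ne_top {m : ℕ → ℕ} {ε c : ℝ} (hβ : IsCost β) (ht : IsTameWith ε c β)
    (hε : ε < 1) (hu : IsTypical β α u)
    (hm : Tendsto (fun n : ℕ => (m n : ℝ) / n) atTop (𝓝 α)) (k : ℕ) :
    limitTerm β α u k ≠ ⊤ := by
  obtain ⟨a, b, hv, hab, -⟩ := hu.eventually_quantBounds_eq hm k
  obtain ⟨j, -, hvj, -⟩ := hu.exists_pivot hab
  rw [limitTerm, valPivot, hv, hvj, ENat.toNat_natCast]
  refine ((lintegral_mono_set (Set.Ioo_subset_Ioo (hu.endpoint_mem a).1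
    (hu.endpoint_mem b).2)).trans_lt ?_).ne
  exact (integrableOn_cost hβ ht hε (hu.mem_Ioo j)).lintegral_lt_top

end

/-! ### Uniform seeds are almost surely typical -/

lemma tendsto_sum_div_of_shift {f : ℕ → ℝ} {l : ℝ} (N : ℕ)
    (h : Tendsto (fun n : ℕ => (∑ i ∈ Finset.range n, f (i + N)) / (n : ℝ)) atTop (𝓝 l)) :
    Tendsto (fun n : ℕ => (∑ i ∈ Finset.range n, f i) / (n : ℝ)) atTop (𝓝 l) := by
  rw [← tendsto_add_atTop_iff_nat N]
  have h1 : Tendsto (fun n : ℕ => (∑ i ∈ Finset.range N, f i) / ((n + N : ℕ) : ℝ)) atTop (𝓝 0) :=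
    (tendsto_add_atTop_iff_nat (f := fun n : ℕ => (∑ i ∈ Finset.range N, f i) / (n : ℝ)) N).mpr
      (tendsto_const_div_atTop_nhds_zero_nat _)
  have h2 : Tendsto (fun n : ℕ => (n : ℝ) / ((n : ℝ) + N)) atTop (𝓝 1) :=
    tendsto_natCast_div_add_atTop _
  have h3 := h1.add (h.mul h2)
  rw [zero_add, mul_one] at h3
  refine h3.congr' ?_
  filter_upwards [eventually_gt_atTop 0] with n hn
  have hn' : (n : ℝ) ≠ 0 := by exact_mod_cast hn.ne'
  have hnN : (n : ℝ) + N ≠ 0 := by positivity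
  rw [add_comm n N, Finset.sum_range_add]
  push_cast
  rw [add_comm (N : ℝ) n]
  simp_rw [add_comm N]
  field_simp

/-- The strong law of large numbers for a function of a uniform seed and of a parameter that is
determined by finitely many of the seeds. -/
lemma ae_tendsto_average
    {Ω : Type*} [MeasurableSpace Ω] {P : Measure Ω} [IsProbabilityMeasure P] {U : ℕ → Ω → ℝ}
    (hU_meas : ∀ i, Measurable (U i)) (hU_indep : iIndepFun U P)
    (hU_unif : ∀ i, P.map (U i) = volume.restrict (Set.Ioo (0 : ℝ) 1))
    {E : Type*} [MeasurableSpace E] {N : ℕ} {X : Ω → E}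
    (hX : Measurable[⨆ i ∈ Set.Iio N, MeasurableSpace.comap (U i) inferInstance] X)
    {g : E → ℝ → ℝ} (hg : Measurable (Function.uncurry g))
    (hint : ∀ᵐ ω ∂P, IntegrableOn (g (X ω)) (Set.Ioo 0 1)) :
    ∀ᵐ ω ∂P, Tendsto (fun n : ℕ => (∑ i ∈ Finset.range n, g (X ω) (U i ω)) / (n : ℝ)) atTop
      (𝓝 (∫ v in Set.Ioo (0 : ℝ) 1, g (X ω) v)) := by
  have hle : ∀ i, MeasurableSpace.comap (U i) inferInstance ≤ (inferInstance : MeasurableSpace Ω) :=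
    fun i => (hU_meas i).comap_le
  have hX' : Measurable X := hX.mono (iSup₂_le fun i _ => hle i) le_rfl
  let Y : Ω → ℕ → ℝ := fun ω i => U (i + N) ω
  have hY : Measurable Y := measurable_pi_iff.mpr fun i => hU_meas _
  have hY' : Measurable[⨆ i ∈ Set.Ici N, MeasurableSpace.comap (U i) inferInstance] Y := by
    refine @measurable_pi_lambda _ _ _ (_) _ _ fun i => ?_
    refine Measurable.mono (comap_measurable (U (i + N))) ?_ le_rfl
    exact le_iSup₂_of_le (i + N) (by simp) le_rfl
  have hXY : IndepFun X Y P := by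
    have h := indep_iSup_of_disjoint hle hU_indep
      (S := Set.Iio N) (T := Set.Ici N) (by
        rw [Set.disjoint_left]; intro i h1 h2
        exact absurd (Set.mem_Ici.mp h2) (not_le.mpr (Set.mem_Iio.mp h1)))
    exact indep_of_indep_of_le_left (indep_of_indep_of_le_right h hY'.comap_le) hX.comap_le
  have hmap := (indepFun_iff_map_prod_eq_prod_map_map hX'.aemeasurable hY.aemeasurable).mp hXY
  let p : E × (ℕ → ℝ) → Prop := fun z =>
    Tendsto (fun n : ℕ => (∑ i ∈ Finset.range n, g z.1 (z.2 i)) / (n : ℝ) -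
      ∫ v in Set.Ioo (0 : ℝ) 1, g z.1 v) atTop (𝓝 0)
  have hp : MeasurableSet {z | p z} := by
    refine measurableSet_tendsto _ fun n => ?_
    refine Measurable.sub (Measurable.div_const ?_ _) ?_
    · refine Finset.measurable_fun_sum _ fun i _ => ?_
      exact hg.comp (measurable_fst.prodMk ((measurable_pi_apply i).comp measurable_snd))
    · have : StronglyMeasurable fun x => ∫ v in Set.Ioo (0 : ℝ) 1, g x v :=
        hg.stronglyMeasurable.integral_prod_right
      exact this.measurable.comp measurable_fst
  have hintX : ∀ᵐ x ∂(P.map X), IntegrableOn (g x) (Set.Ioo 0 1) :=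
    (ae_map_iff hX'.aemeasurable (_root_.measurableSet_integrable hg.stronglyMeasurable)).mpr hint
  have hprod : ∀ᵐ z ∂((P.map X).prod (P.map Y)), p z := by
    have : IsProbabilityMeasure (P.map Y) := Measure.isProbabilityMeasure_map hY.aemeasurable
    have : IsProbabilityMeasure (P.map X) := Measure.isProbabilityMeasure_map hX'.aemeasurable
    rw [Measure.ae_prod_iff_ae_ae hp]
    filter_upwards [hintX] with x hx
    have hpx : MeasurableSet {y | p (x, y)} := measurable_prodMk_left hp
    rw [ae_map_iff hY.aemeasurable hpx]
    have hgx : Measurable (g x) := hg.comp measurable_prodMk_left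
    have hlaw := strong_law_ae_real (μ := P) (fun i ω => g x (U (i + N) ω)) (by
        have := hx
        rw [IntegrableOn, ← hU_unif (0 + N)] at this
        exact this.comp_measurable (hU_meas _)) (by
        intro i l hil
        exact (hU_indep.indepFun (by simpa using hil)).comp hgx hgx)
      fun i => by
        refine IdentDistrib.comp ⟨(hU_meas _).aemeasurable, (hU_meas _).aemeasurable, ?_⟩ hgx
        rw [hU_unif, hU_unif]
    have hE : P[fun ω => g x (U (0 + N) ω)] = ∫ v in Set.Ioo (0 : ℝ) 1, g x v := by
      rw [← hU_unif (0 + N), integral_map (hU_meas _).aemeasurable hgx.aestronglyMeasurable]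
    rw [hE] at hlaw
    filter_upwards [hlaw] with ω hω
    have := hω.sub_const (∫ v in Set.Ioo (0 : ℝ) 1, g x v)
    rwa [sub_self] at this
  rw [← hmap] at hprod
  have := ae_of_ae_map (hX'.prodMk hY).aemeasurable hprod
  filter_upwards [this] with ω hω
  refine tendsto_sum_div_of_shift N ?_
  have h2 := Tendsto.add_const (∫ v in Set.Ioo (0 : ℝ) 1, g (X ω) v) hω
  simpa [Y] using h2

lemma measurable_endpoint {Ω : Type*} {U : ℕ → Ω → ℝ} (a : ℕ) {N : ℕ} (ha : a < N + 2) :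
    Measurable[⨆ i ∈ Set.Iio N, MeasurableSpace.comap (U i) inferInstance]
      fun ω => endpoint (fun i => U i ω) a := by
  match a with
  | 0 => exact measurable_const
  | 1 => exact measurable_const
  | i + 2 =>
    refine Measurable.mono (comap_measurable (U i)) ?_ le_rfl
    exact le_iSup₂_of_le i (Set.mem_Iio.mpr (by omega)) le_rfl

lemma ae_mem_Ioo {Ω : Type*} [MeasurableSpace Ω] {P : Measure Ω} {U : ℕ → Ω → ℝ}
    (hU_meas : ∀ i, Measurable (U i))
    (hU_unif : ∀ i, P.map (U i) = volume.restrict (Set.Ioo (0 : ℝ) 1)) :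
    ∀ᵐ ω ∂P, ∀ i, U i ω ∈ Set.Ioo (0 : ℝ) 1 := by
  refine ae_all_iff.mpr fun i => ae_of_ae_map (hU_meas i).aemeasurable ?_
  rw [hU_unif i]
  exact ae_restrict_mem measurableSet_Ioo

lemma ae_isTypical
    {Ω : Type*} [MeasurableSpace Ω] {P : Measure Ω} [IsProbabilityMeasure P] {U : ℕ → Ω → ℝ}
    (hU_meas : ∀ i, Measurable (U i)) (hU_indep : iIndepFun U P)
    (hU_unif : ∀ i, P.map (U i) = volume.restrict (Set.Ioo (0 : ℝ) 1))
    {β : ℝ → ℝ → ℝ} (hβ : IsCost β) {ε c : ℝ} (ht : IsTameWith ε c β) (hε : ε < 1) (α : ℝ) :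
    ∀ᵐ ω ∂P, IsTypical β α fun i => U i ω := by
  have hmem := ae_mem_Ioo hU_meas hU_unif
  have hne : ∀ᵐ ω ∂P, ∀ i, U i ω ≠ α := by
    refine ae_all_iff.mpr fun i =>
      ae_of_ae_map (hU_meas i).aemeasurable (p := fun x => x ≠ α) ?_
    rw [hU_unif i]
    exact ae_restrict_of_ae (Measure.ae_ne volume α)
  -- the parameter consists of the seed of a pivot and of the ends of an interval
  have hX : ∀ j a b : ℕ, Measurable[⨆ i ∈ Set.Iio (j + a + b + 1),
      MeasurableSpace.comap (U i) inferInstance] fun ω =>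
        (endpoint (fun i => U i ω) (j + 2), endpoint (fun i => U i ω) a,
          endpoint (fun i => U i ω) b) := fun j a b =>
    (measurable_endpoint (j + 2) (by omega)).prodMk
      ((measurable_endpoint a (by omega)).prodMk (measurable_endpoint b (by omega)))
  have hmS : MeasurableSet {z : (ℝ × ℝ × ℝ) × ℝ | z.2 ∈ Set.Ioo z.1.2.1 z.1.2.2} := by
    have h1 : MeasurableSet {z : (ℝ × ℝ × ℝ) × ℝ | z.1.2.1 < z.2} :=
      measurableSet_lt (by fun_prop) (by fun_prop)
    have h2 : MeasurableSet {z : (ℝ × ℝ × ℝ) × ℝ | z.2 < z.1.2.2} :=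
      measurableSet_lt (by fun_prop) (by fun_prop)
    exact h1.inter h2
  have havg : ∀ᵐ ω ∂P, ∀ j a b, Tendsto (fun n : ℕ => (∑ i ∈ Finset.range n,
      (Set.Ioo (endpoint (fun i => U i ω) a) (endpoint (fun i => U i ω) b)).indicator
        (fun v => β v (U j ω)) (U i ω)) / (n : ℝ)) atTop
      (𝓝 (∫ v in Set.Ioo (0 : ℝ) 1,
        (Set.Ioo (endpoint (fun i => U i ω) a) (endpoint (fun i => U i ω) b)).indicator
          (fun v => β v (U j ω)) v)) := by
    refine ae_all_iff.mpr fun j => ae_all_iff.mpr fun a => ae_all_iff.mpr fun b => ?_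
    refine ae_tendsto_average hU_meas hU_indep hU_unif (hX j a b)
      (g := fun x v => (Set.Ioo x.2.1 x.2.2).indicator (fun v => β v x.1) v) ?_ ?_
    · have h1 : Measurable fun z : (ℝ × ℝ × ℝ) × ℝ => β z.2 z.1.1 :=
        hβ.measurable.comp (measurable_snd.prodMk (measurable_fst.comp measurable_fst))
      exact h1.indicator hmS
    · filter_upwards [hmem] with ω hω
      exact (integrableOn_cost hβ ht hε (hω j)).indicator measurableSet_Ioo
  have hlen : ∀ᵐ ω ∂P, ∀ a b, Tendsto (fun n : ℕ => (∑ i ∈ Finset.range n,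
      (Set.Ioo (endpoint (fun i => U i ω) a) (endpoint (fun i => U i ω) b)).indicator
        (fun _ => (1 : ℝ)) (U i ω)) / (n : ℝ)) atTop
      (𝓝 (∫ v in Set.Ioo (0 : ℝ) 1,
        (Set.Ioo (endpoint (fun i => U i ω) a) (endpoint (fun i => U i ω) b)).indicator
          (fun _ => (1 : ℝ)) v)) := by
    refine ae_all_iff.mpr fun a => ae_all_iff.mpr fun b => ?_
    refine ae_tendsto_average hU_meas hU_indep hU_unif (hX 0 a b)
      (g := fun x v => (Set.Ioo x.2.1 x.2.2).indicator (fun _ => (1 : ℝ)) v) ?_ ?_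
    · have h1 : Measurable fun _ : (ℝ × ℝ × ℝ) × ℝ => (1 : ℝ) := measurable_const
      exact h1.indicator hmS
    · refine Eventually.of_forall fun ω => ?_
      have : IntegrableOn (fun _ : ℝ => (1 : ℝ)) (Set.Ioo (0 : ℝ) 1) := by simp
      exact this.indicator measurableSet_Ioo
  have hrank : ∀ᵐ ω ∂P, ∀ j, Tendsto (fun n : ℕ => (∑ i ∈ Finset.range n,
      (Set.Iic (U j ω)).indicator (fun _ => (1 : ℝ)) (U i ω)) / (n : ℝ)) atTop
      (𝓝 (∫ v in Set.Ioo (0 : ℝ) 1, (Set.Iic (U j ω)).indicator (fun _ => (1 : ℝ)) v)) := by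
    refine ae_all_iff.mpr fun j => ?_
    refine ae_tendsto_average hU_meas hU_indep hU_unif
      (measurable_endpoint (j + 2) (N := j + 1) (by omega))
      (g := fun x v => (Set.Iic x).indicator (fun _ => (1 : ℝ)) v) ?_ ?_
    · have h1 : Measurable fun _ : ℝ × ℝ => (1 : ℝ) := measurable_const
      exact h1.indicator (measurableSet_le measurable_snd measurable_fst)
    · refine Eventually.of_forall fun ω => ?_
      have : IntegrableOn (fun _ : ℝ => (1 : ℝ)) (Set.Ioo (0 : ℝ) 1) := by simp
      exact this.indicator measurableSet_Iic
  filter_upwards [hmem, hne, havg, hlen, hrank] with ω h1 h2 h3 h4 h5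
  refine ⟨h1, h2, fun j => ?_, fun a b hab => ?_, h3⟩
  · have h := h5 j
    have hint : ∫ v in Set.Ioo (0 : ℝ) 1, (Set.Iic (U j ω)).indicator (fun _ => (1 : ℝ)) v =
        U j ω := by
      rw [integral_indicator measurableSet_Iic, Measure.restrict_restrict measurableSet_Iic]
      have hset : Set.Iic (U j ω) ∩ Set.Ioo 0 1 = Set.Ioc 0 (U j ω) := by
        ext x
        simp only [Set.mem_inter_iff, Set.mem_Iic, Set.mem_Ioo, Set.mem_Ioc]
        constructor
        · rintro ⟨a, b, -⟩; exact ⟨b, a⟩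
        · rintro ⟨a, b⟩; exact ⟨b, a, b.trans_lt (h1 j).2⟩
      rw [hset]
      simp [(h1 j).1.le]
    rw [hint] at h
    refine h.congr fun n => ?_
    simp [rank, Set.indicator_apply]
  · by_contra! hcon
    have h := h4 a b
    have hb : ∀ a, 0 ≤ endpoint (fun i => U i ω) a ∧ endpoint (fun i => U i ω) a ≤ 1 := by
      intro a
      match a with
      | 0 => simp [endpoint]
      | 1 => simp [endpoint]
      | i + 2 => exact ⟨(h1 i).1.le, (h1 i).2.le⟩
    rw [integral_indicator measurableSet_Ioo, Measure.restrict_restrict measurableSet_Ioo,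
      Set.inter_eq_left.mpr (Set.Ioo_subset_Ioo (hb a).1 (hb b).2)] at h
    have h0 : ∀ i, (Set.Ioo (endpoint (fun i => U i ω) a) (endpoint (fun i => U i ω) b)).indicator
        (fun _ => (1 : ℝ)) (U i ω) = 0 := fun i =>
      Set.indicator_of_notMem (fun hi => absurd hi.2 (not_lt.mpr (hcon i hi.1))) _
    simp only [h0, Finset.sum_const_zero, zero_div] at h
    have := tendsto_nhds_unique h tendsto_const_nhds
    simp [hab.le] at this
    linarith

/-! ### Convergence in `L^p` of a series, term by term -/

section Series

variable {Ω : Type*} [MeasurableSpace Ω] {P : Measure Ω}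

/-- Minkowski's inequality for a series. -/
lemma eLpNorm_le_tsum {p : ℝ≥0∞} (hp : 1 ≤ p) {f : ℕ → Ω → ℝ} {F : Ω → ℝ}
    (hf : ∀ k, AEStronglyMeasurable (f k) P) (hF : ∀ᵐ ω ∂P, HasSum (fun k => f k ω) (F ω)) :
    eLpNorm F p P ≤ ∑' k, eLpNorm (f k) p P := by
  refine (Lp.eLpNorm_lim_le_liminf_eLpNorm (f := fun N => ∑ k ∈ Finset.range N, f k)
    (fun N => Finset.aestronglyMeasurable_sum _ fun k _ => hf k) F ?_).trans ?_
  · filter_upwards [hF] with ω hω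
    simpa using hω.tendsto_sum_nat
  · refine (liminf_le_liminf (Eventually.of_forall fun N =>
      (eLpNorm_sum_le (fun k _ => hf k) hp).trans (ENNReal.sum_le_tsum _))).trans ?_
    simp

lemma aestronglyMeasurable_of_hasSum {f : ℕ → Ω → ℝ} {F : Ω → ℝ}
    (hf : ∀ k, AEStronglyMeasurable (f k) P) (hF : ∀ᵐ ω ∂P, HasSum (fun k => f k ω) (F ω)) :
    AEStronglyMeasurable F P := by
  refine aestronglyMeasurable_of_tendsto_ae atTop
    (f := fun N => ∑ k ∈ Finset.range N, f k)
    (fun N => Finset.aestronglyMeasurable_sum _ fun k _ => hf k) ?_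
  filter_upwards [hF] with ω hω
  simpa using hω.tendsto_sum_nat

/-- A sequence that is bounded in `L^q` is uniformly integrable in `L^p` for `p < q`. -/
lemma unifIntegrable_of_eLpNorm_le {p q B : ℝ≥0∞} (hp : p ≠ 0) (hpq : p < q) (hq : q ≠ ⊤)
    (hB : B ≠ ⊤) {f : ℕ → Ω → ℝ} (hf : ∀ n, AEStronglyMeasurable (f n) P)
    (hle : ∀ n, eLpNorm (f n) q P ≤ B) : UnifIntegrable f p P := by
  intro ε hε
  have hp0 : 0 < p.toReal := ENNReal.toReal_pos hp (hpq.trans_le le_top).ne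
  have hpq' : p.toReal < q.toReal := ENNReal.toReal_strict_mono hq hpq
  set γ := 1 / p.toReal - 1 / q.toReal with hγ
  have hγ0 : 0 < γ := sub_pos.mpr (one_div_lt_one_div_of_lt hp0 hpq')
  have hB0 : 0 ≤ B.toReal := ENNReal.toReal_nonneg
  refine ⟨(ε / (B.toReal + 1)) ^ (1 / γ), by positivity, fun n s hs hsδ => ?_⟩
  rw [eLpNorm_indicator_eq_eLpNorm_restrict hs]
  calc eLpNorm (f n) p (P.restrict s)
      ≤ eLpNorm (f n) q (P.restrict s) * (P.restrict s) Set.univ ^ γ :=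
        eLpNorm_le_eLpNorm_mul_rpow_measure_univ hpq.le (hf n).restrict
    _ ≤ B * ENNReal.ofReal ((ε / (B.toReal + 1)) ^ (1 / γ)) ^ γ := by
        rw [Measure.restrict_apply_univ]
        gcongr
        exact (eLpNorm_mono_measure _ Measure.restrict_le_self).trans (hle n)
    _ = ENNReal.ofReal (B.toReal * (ε / (B.toReal + 1))) := by
        rw [ENNReal.ofReal_rpow_of_nonneg (by positivity) hγ0.le, ← Real.rpow_mul (by positivity),
          one_div_mul_cancel hγ0.ne', Real.rpow_one, ENNReal.ofReal_mul hB0,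
          ENNReal.ofReal_toReal hB]
    _ ≤ ENNReal.ofReal ε := by
        refine ENNReal.ofReal_le_ofReal ?_
        rw [mul_div_assoc', div_le_iff₀ (by positivity)]
        nlinarith

variable {p q : ℝ≥0∞} {X : ℕ → ℕ → Ω → ℝ} {I : ℕ → Ω → ℝ}
  {B : ℕ → ℝ≥0∞}

lemma eLpNorm_limit_le (hX : ∀ n k, AEStronglyMeasurable (X n k) P)
    (hXB : ∀ n k, eLpNorm (X n k) q P ≤ B k)
    (hlim : ∀ k, ∀ᵐ ω ∂P, Tendsto (fun n => X n k ω) atTop (𝓝 (I k ω))) (k : ℕ) :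
    eLpNorm (I k) q P ≤ B k := by
  refine (Lp.eLpNorm_lim_le_liminf_eLpNorm (fun n => hX n k) (I k) (hlim k)).trans ?_
  refine (liminf_le_liminf (Eventually.of_forall fun n => hXB n k)).trans ?_
  simp

/-- If the terms of random series converge almost surely and are bounded in `L^q` by a summable
sequence, then the sums converge in `L^p` for every `p < q`. -/
lemma tendsto_eLpNorm_series [IsProbabilityMeasure P] (hp : 1 ≤ p) (hpq : p < q) (hq : q ≠ ⊤)
    (hX : ∀ n k, AEStronglyMeasurable (X n k) P) (hB : ∑' k, B k ≠ ⊤)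
    (hXB : ∀ n k, eLpNorm (X n k) q P ≤ B k)
    (hlim : ∀ k, ∀ᵐ ω ∂P, Tendsto (fun n => X n k ω) atTop (𝓝 (I k ω)))
    {Y : ℕ → Ω → ℝ} {S : Ω → ℝ} (hY : ∀ n, ∀ᵐ ω ∂P, HasSum (fun k => X n k ω) (Y n ω))
    (hS : ∀ᵐ ω ∂P, HasSum (fun k => I k ω) (S ω)) :
    Tendsto (fun n => eLpNorm (fun ω => Y n ω - S ω) p P) atTop (𝓝 0) := by
  have hp' : p ≠ ⊤ := (hpq.trans_le le_top).ne
  have hI : ∀ k, AEStronglyMeasurable (I k) P := fun k =>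
    aestronglyMeasurable_of_tendsto_ae atTop (fun n => hX n k) (hlim k)
  have hIB := eLpNorm_limit_le hX hXB hlim
  have hBk : ∀ k, B k ≠ ⊤ := fun k => ENNReal.ne_top_of_tsum_ne_top hB k
  have hpX : ∀ n k, eLpNorm (X n k) p P ≤ B k := fun n k =>
    (eLpNorm_le_eLpNorm_of_exponent_le hpq.le (hX n k)).trans (hXB n k)
  have hpI : ∀ k, eLpNorm (I k) p P ≤ B k := fun k =>
    (eLpNorm_le_eLpNorm_of_exponent_le hpq.le (hI k)).trans (hIB k)
  have hterm : ∀ k, Tendsto (fun n => eLpNorm (X n k - I k) p P) atTop (𝓝 0) := fun k =>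
    tendsto_Lp_finite_of_tendsto_ae hp hp' (fun n => hX n k)
      ⟨hI k, (hpI k).trans_lt (hBk k).lt_top⟩
      (unifIntegrable_of_eLpNorm_le (by positivity) hpq hq (hBk k) (fun n => hX n k)
        fun n => hXB n k) (hlim k)
  have hsum : Tendsto (fun n => ∑' k, eLpNorm (X n k - I k) p P) atTop (𝓝 0) := by
    have h := tendsto_lintegral_of_dominated_convergence (μ := Measure.count)
      (F := fun n k => eLpNorm (X n k - I k) p P) (f := fun _ => 0) (fun k => B k + B k)
      (fun n => Measurable.of_discrete) (fun n => Eventually.of_forall fun k =>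
        (eLpNorm_sub_le (hX n k) (hI k) hp).trans (add_le_add (hpX n k) (hpI k)))
      (by
        rw [lintegral_count, ENNReal.tsum_add]
        exact ENNReal.add_ne_top.mpr ⟨hB, hB⟩)
      (Eventually.of_forall hterm)
    simpa [lintegral_count] using h
  refine tendsto_of_tendsto_of_tendsto_of_le_of_le tendsto_const_nhds hsum
    (fun n => zero_le) fun n => ?_
  refine eLpNorm_le_tsum hp (fun k => (hX n k).sub (hI k)) ?_
  filter_upwards [hY n, hS] with ω h1 h2
  exact h1.sub h2

end Series

/-! ### Moments of the cost of a round -/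

section RoundMoments

variable {Ω : Type*} [MeasurableSpace Ω] {P : Measure Ω} {U : ℕ → Ω → ℝ}

/-- The mean of a function of finitely many independent uniform seeds, as an iterated integral. -/
lemma lintegral_eq_lmarginal [IsProbabilityMeasure P] (hU_meas : ∀ i, Measurable (U i)) (hU_indep : iIndepFun U P)
    (hU_unif : ∀ i, P.map (U i) = volume.restrict (Set.Ioo (0 : ℝ) 1)) {A : Finset ℕ}
    {f : (ℕ → ℝ) → ℝ≥0∞} (hf : Measurable f)
    (h : ∀ u v : ℕ → ℝ, (∀ i ∈ A, u i = v i) → f u = f v) :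
    ∫⁻ ω, f (fun i => U i ω) ∂P =
      (∫⋯∫⁻_A, f ∂(fun _ => volume.restrict (Set.Ioo (0 : ℝ) 1))) 0 := by
  have hX : Measurable fun ω (i : A) => U i ω := measurable_pi_iff.mpr fun i => hU_meas i
  have hmap := (iIndepFun_iff_map_fun_eq_pi_map (μ := P) (f := fun i : A => U i)
    fun i => (hU_meas i).aemeasurable).mp (hU_indep.precomp Subtype.val_injective)
  simp only [hU_unif] at hmap
  unfold lmarginal
  rw [← hmap]
  refine Eq.trans ?_ (lintegral_map (f := fun y => f (Function.updateFinset 0 A y))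
    (hf.comp measurable_updateFinset) hX).symm
  refine lintegral_congr fun ω => h _ _ fun i hi => ?_
  simp [Function.updateFinset, hi]

variable {β : ℝ → ℝ → ℝ} {ε c q : ℝ}

lemma measurable_ofReal_cost (hβ : IsCost β) :
    Measurable (Function.uncurry fun v t => ENNReal.ofReal (β v t)) :=
  ENNReal.measurable_ofReal.comp hβ.measurable

lemma aestronglyMeasurable_quantTerm (hU_meas : ∀ i, Measurable (U i))
    (hU_unif : ∀ i, P.map (U i) = volume.restrict (Set.Ioo (0 : ℝ) 1)) (hβ : IsCost β)
    (n m k : ℕ) :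
    AEStronglyMeasurable (fun ω => quantTerm β n m (fun i => U i ω) k / (n : ℝ)) P := by
  have hm : Measurable fun ω => (roundCost (fun v t => ENNReal.ofReal (β v t)) k
      (Finset.range n, m) fun i => U i ω).toReal / (n : ℝ) :=
    (((measurable_roundCost (measurable_ofReal_cost hβ) k _).comp
      (measurable_pi_iff.mpr hU_meas)).ennreal_toReal).div_const _
  refine hm.aestronglyMeasurable.congr ?_
  filter_upwards [ae_mem_Ioo hU_meas hU_unif] with ω hω
  rw [quantTerm_eq_toReal hβ hω]

/-- The constant in the bound `eLpNorm_quantTerm_le`. -/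
def roundConst (c q s : ℝ) : ℝ := tameConst c q s / growth s 0 * growth s 1

/-- In `L^q`, the costs of the rounds are dominated by a geometric series, uniformly in the number of
keys and in the target rank. -/
lemma eLpNorm_quantTerm_le [IsProbabilityMeasure P] (hU_meas : ∀ i, Measurable (U i)) (hU_indep : iIndepFun U P)
    (hU_unif : ∀ i, P.map (U i) = volume.restrict (Set.Ioo (0 : ℝ) 1)) (hβ : IsCost β)
    (ht : IsTameWith ε c β) (hq : 1 ≤ q) (hs : ε * q < 1) (n m k : ℕ) :
    eLpNorm (fun ω => quantTerm β n m (fun i => U i ω) k / (n : ℝ)) (ENNReal.ofReal q) P ≤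
      ENNReal.ofReal (roundConst c q (ε * q) ^ (1 / q) * (shrink (q - ε * q) ^ (1 / q)) ^ k) := by
  have hq0 : 0 < q := by linarith
  set s := ε * q with hsdef
  have hs0 : 0 < s := mul_pos ht.1 hq0
  have hK := tameConst_nonneg (q := q) ht.2.1 hs
  have hg0 := growth_pos hs 0
  have hg1 := growth_pos hs 1
  have hr := shrink_pos (q - s)
  rcases n with _ | n
  · simp
  set b : ℝ → ℝ → ℝ≥0∞ := fun v t => ENNReal.ofReal (β v t) with hb
  have hmb : Measurable (Function.uncurry b) := measurable_ofReal_cost hβ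
  have hmean : ∫⁻ ω, roundCost b k (Finset.range (n + 1), m) (fun i => U i ω) ^ q ∂P ≤
      ENNReal.ofReal (momentBound (tameConst c q s) q s k (n + 1)) := by
    rw [lintegral_eq_lmarginal hU_meas hU_indep hU_unif (A := Finset.range (n + 1))
      ((measurable_roundCost hmb k (Finset.range (n + 1), m)).pow_const q)
      fun u v h => by rw [roundCost_congr b k h]]
    have h := lmarginal_roundCost_le hmb hq hs0 hs hK
      (fun a t d h1 h2 h3 h4 => lintegral_rpow_cost_le hβ ht hq0 hs a t d h1 h2 h3 h4)
      k (Finset.range (n + 1)) m le_rfl zero_lt_one le_rfl 0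
    simpa using h
  have hbound : momentBound (tameConst c q s) q s k (n + 1) / ((n + 1 : ℕ) : ℝ) ^ q ≤
      roundConst c q s * shrink (q - s) ^ k := by
    have hn : (0 : ℝ) < (n + 1 : ℕ) := by positivity
    rw [div_le_iff₀ (by positivity), momentBound, roundConst]
    calc _ ≤ tameConst c q s / growth s 0 * shrink (q - s) ^ k *
          (growth s 1 * ((n + 1 : ℕ) : ℝ) ^ s) * ((n + 1 : ℕ) : ℝ) ^ (q - s) := by
          gcongr
          have := growth_le_mul_rpow hs0 hs n
          push_cast
          exact this
      _ = tameConst c q s / growth s 0 * growth s 1 * shrink (q - s) ^ k *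
          (((n + 1 : ℕ) : ℝ) ^ s * ((n + 1 : ℕ) : ℝ) ^ (q - s)) := by ring
      _ = _ := by rw [← Real.rpow_add hn]; congr 2; ring
  rw [eLpNorm_eq_lintegral_rpow_enorm_toReal (by simpa using hq0) ENNReal.ofReal_ne_top,
    ENNReal.toReal_ofReal hq0.le]
  have hae : ∫⁻ ω, ‖quantTerm β (n + 1) m (fun i => U i ω) k / ((n + 1 : ℕ) : ℝ)‖ₑ ^ q ∂P =
      (∫⁻ ω, roundCost b k (Finset.range (n + 1), m) (fun i => U i ω) ^ q ∂P) *
        (ENNReal.ofReal (((n + 1 : ℕ) : ℝ) ^ q))⁻¹ := by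
    rw [← lintegral_mul_const]
    · refine lintegral_congr_ae ?_
      filter_upwards [ae_mem_Ioo hU_meas hU_unif] with ω hω
      rw [Real.enorm_of_nonneg (div_nonneg (quantTerm_nonneg hβ hω k) (by positivity)),
        ENNReal.ofReal_div_of_pos (by positivity), ofReal_quantTerm hβ hω, div_eq_mul_inv,
        ENNReal.mul_rpow_of_nonneg _ _ hq0.le, ENNReal.inv_rpow,
        ENNReal.ofReal_rpow_of_nonneg (by positivity) hq0.le]
    · exact ((measurable_roundCost hmb k _).comp (measurable_pi_iff.mpr hU_meas)).pow_const q
  rw [hae]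
  calc _ ≤ (ENNReal.ofReal (momentBound (tameConst c q s) q s k (n + 1)) *
        (ENNReal.ofReal (((n + 1 : ℕ) : ℝ) ^ q))⁻¹) ^ (1 / q) := by gcongr
    _ ≤ ENNReal.ofReal (roundConst c q s * shrink (q - s) ^ k) ^ (1 / q) := by
        gcongr
        rw [← div_eq_mul_inv, ← ENNReal.ofReal_div_of_pos (by positivity)]
        exact ENNReal.ofReal_le_ofReal hbound
    _ = _ := by
        have h0 : 0 ≤ roundConst c q s := by unfold roundConst; positivity
        rw [ENNReal.ofReal_rpow_of_nonneg (by positivity) (by positivity),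
          Real.mul_rpow h0 (by positivity), ← Real.rpow_natCast, ← Real.rpow_natCast,
          ← Real.rpow_mul hr.le, ← Real.rpow_mul hr.le, mul_comm (k : ℝ)]

end RoundMoments

end QuickSelect

end

open QuickSelect MeasureTheory ProbabilityTheory Filter Topology in
theorem theorem4p1 {Ω : Type*} [MeasurableSpace Ω]
    (P : MeasureTheory.Measure Ω) [MeasureTheory.IsProbabilityMeasure P]
    (U : ℕ → Ω → ℝ) (hU_meas : ∀ i, Measurable (U i))
    (hU_indep : ProbabilityTheory.iIndepFun U P)
    (hU_unif : ∀ i, P.map (U i) = MeasureTheory.volume.restrict (Set.Ioo (0 : ℝ) 1))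
    (α : ℝ) (hα : α ∈ Set.Icc (0 : ℝ) 1)
    (m : ℕ → ℕ) (hm : ∀ n, 1 ≤ n → 1 ≤ m n ∧ m n ≤ n)
    (hm_lim : Filter.Tendsto (fun n : ℕ => (m n : ℝ) / (n : ℝ)) Filter.atTop (nhds α))
    (p : ℝ) (hp : 1 ≤ p) (ε : ℝ) (hε : ε < 1 / p)
    (β : ℝ → ℝ → ℝ) (hβ : QuickSelect.IsCost β) (hβ_tame : QuickSelect.IsTame ε β) :
    (∀ᵐ ω ∂P, QuickSelect.limitS β α (fun i => U i ω) < ⊤) ∧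
    MeasureTheory.MemLp (fun ω => (QuickSelect.limitS β α (fun i => U i ω)).toReal)
      (ENNReal.ofReal p) P ∧
    (∀ n, MeasureTheory.MemLp
      (fun ω => QuickSelect.quantCost β n (m n) (fun i => U i ω) / (n : ℝ))
      (ENNReal.ofReal p) P) ∧
    Filter.Tendsto
      (fun n : ℕ => MeasureTheory.eLpNorm
        (fun ω => QuickSelect.quantCost β n (m n) (fun i => U i ω) / (n : ℝ) -
          (QuickSelect.limitS β α (fun i => U i ω)).toReal)
        (ENNReal.ofReal p) P)
      Filter.atTop (nhds 0) := by
  obtain ⟨c, ht⟩ := hβ_tame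
  have hε0 : 0 < ε := ht.1
  have hp0 : 0 < p := by linarith
  -- an exponent `q > p` with `ε * q < 1`
  have hlt : p < 1 / ε := by
    rw [lt_div_iff₀ hε0, mul_comm]
    rwa [lt_div_iff₀ hp0] at hε
  obtain ⟨q, hpq, hqε⟩ := exists_between hlt
  have hq : 1 ≤ q := by linarith
  have hq0 : 0 < q := by linarith
  have hs : ε * q < 1 := by
    rw [lt_div_iff₀ hε0] at hqε
    linarith
  have hε1 : ε < 1 := lt_of_le_of_lt (by nlinarith) hs
  have hp1 : 1 ≤ ENNReal.ofReal p := by simpa using hp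
  have hpq' : ENNReal.ofReal p < ENNReal.ofReal q := (ENNReal.ofReal_lt_ofReal_iff hq0).mpr hpq
  set X : ℕ → ℕ → Ω → ℝ := fun n k ω => quantTerm β n (m n) (fun i => U i ω) k / (n : ℝ) with hXdef
  set I : ℕ → Ω → ℝ := fun k ω => (limitTerm β α (fun i => U i ω) k).toReal with hIdef
  set θ : ℝ := shrink (q - ε * q) ^ (1 / q) with hθ
  have hqs : 0 < q - ε * q := by linarith
  have hθ0 : 0 ≤ θ := Real.rpow_nonneg (shrink_pos _).le _
  have hθ1 : θ < 1 := Real.rpow_lt_one (shrink_pos _).le (shrink_lt_one hqs) (by positivity)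
  set B : ℕ → ENNReal := fun k =>
    ENNReal.ofReal (roundConst c q (ε * q) ^ (1 / q) * θ ^ k) with hBdef
  have hB : ∑' k, B k ≠ ⊤ := ((summable_geometric_of_lt_one hθ0 hθ1).mul_left _).tsum_ofReal_ne_top
  have hX : ∀ n k, AEStronglyMeasurable (X n k) P := fun n k =>
    aestronglyMeasurable_quantTerm hU_meas hU_unif hβ n (m n) k
  have hXB : ∀ n k, eLpNorm (X n k) (ENNReal.ofReal q) P ≤ B k := fun n k =>
    eLpNorm_quantTerm_le hU_meas hU_indep hU_unif hβ ht hq hs n (m n) k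
  have htyp := ae_isTypical hU_meas hU_indep hU_unif hβ ht hε1 α
  have hlim : ∀ k, ∀ᵐ ω ∂P, Tendsto (fun n => X n k ω) atTop (𝓝 (I k ω)) := fun k => by
    filter_upwards [htyp] with ω hω
    exact hω.tendsto_quantTerm hβ hm_lim k
  have hI : ∀ k, AEStronglyMeasurable (I k) P := fun k =>
    aestronglyMeasurable_of_tendsto_ae atTop (fun n => hX n k) (hlim k)
  have hIB := eLpNorm_limit_le hX hXB hlim
  have hfin : ∀ᵐ ω ∂P, limitS β α (fun i => U i ω) < ⊤ := by
    have h1 : ∫⁻ ω, ∑' k, ‖I k ω‖ₑ ∂P ≠ ⊤ := by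
      rw [lintegral_tsum fun k => (hI k).enorm]
      refine ne_top_of_le_ne_top hB (ENNReal.tsum_le_tsum fun k => ?_)
      rw [← eLpNorm_one_eq_lintegral_enorm]
      exact (eLpNorm_le_eLpNorm_of_exponent_le (hp1.trans hpq'.le) (hI k)).trans (hIB k)
    have h2 := ae_lt_top' (AEMeasurable.tsum fun k => (hI k).enorm) h1
    filter_upwards [h2, htyp] with ω h3 h4
    refine lt_of_eq_of_lt (tsum_congr fun k => ?_) h3
    rw [Real.enorm_of_nonneg ENNReal.toReal_nonneg,
      ENNReal.ofReal_toReal (h4.limitTerm_ne_top hβ ht hε1 hm_lim k)]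
  have hS : ∀ᵐ ω ∂P, HasSum (fun k => I k ω) (limitS β α (fun i => U i ω)).toReal := by
    filter_upwards [hfin] with ω hω
    have h := ENNReal.hasSum_toReal hω.ne
    rwa [← ENNReal.tsum_toReal_eq fun k => ENNReal.ne_top_of_tsum_ne_top hω.ne k] at h
  have hY : ∀ n, ∀ᵐ ω ∂P, HasSum (fun k => X n k ω)
      (quantCost β n (m n) (fun i => U i ω) / (n : ℝ)) := fun n => by
    filter_upwards [ae_mem_Ioo hU_meas hU_unif] with ω hω
    rw [quantCost_eq_sum hβ hω, Finset.sum_div]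
    refine hasSum_sum_of_ne_finset_zero fun k hk => ?_
    simp only [hXdef]
    rw [quantTerm_eq_zero hβ hω (by simpa using hk), zero_div]
  refine ⟨hfin, ⟨aestronglyMeasurable_of_hasSum hI hS, ?_⟩,
    fun n => ⟨aestronglyMeasurable_of_hasSum (hX n) (hY n), ?_⟩, ?_⟩
  · refine (eLpNorm_le_tsum hp1 hI hS).trans_lt (lt_of_le_of_lt ?_ hB.lt_top)
    exact ENNReal.tsum_le_tsum fun k =>
      (eLpNorm_le_eLpNorm_of_exponent_le hpq'.le (hI k)).trans (hIB k)
  · refine (eLpNorm_le_tsum hp1 (hX n) (hY n)).trans_lt (lt_of_le_of_lt ?_ hB.lt_top)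
    exact ENNReal.tsum_le_tsum fun k =>
      (eLpNorm_le_eLpNorm_of_exponent_le hpq'.le (hX n k)).trans (hXB n k)
  · exact tendsto_eLpNorm_series hp1 hpq' ENNReal.ofReal_ne_top hX hB hXB hlim hY hS
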